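/- Let $K>0$. In the complex Hilbert space $L^2(\mathbb{R})=L^2_{\mathbb{C}}(\mathbb{R})$ (Lebesgue measure) let $\bar p_\xi$ be the closure of the operator $C_0^\infty(\mathbb{R},\mathbb{C})\to L^2(\mathbb{R})$, $f\mapsto \frac{i}{K}f'$, and let $A$ be the closure of the operator $C_0^\infty(\mathbb{R},\mathbb{C})\to L^2(\mathbb{R})$, $f\mapsto -\frac{1}{K^2}f''$, where $C_0^\infty(\mathbb{R},\mathbb{C})$ is the space of smooth functions with compact support. Then: 1. $\bar p_\xi^{\,2}=A$ (equality of unbounded operators, including domains, where $D(\bar p_\xi^{\,2})=\{g\in D(\bar p_\xi): \bar p_\xi g\in D(\bar p_\xi)\}$). 2. $\bar p_\xi$ and $A$ commute strongly: both possess a spectral measure (i.e. are self-adjoint), and every spectral projection of $\bar p_\xi$ commutes with every spectral projection of $A$. 3. For $\tau\in\mathbb{R}$ let $\cos(\tau\bar p_\xi)$ and $\frac{\sin(\tau\bar p_\xi)}{\bar p_\xi}$ be the bounded operators which the functional calculus (integration against the spectral measure) of $\bar p_\xi$ attaches to the functions $\lambda\mapsto\cos(\tau\lambda)$ and $\lambda\mapsto\frac{\sin(\tau\lambda)}{\lambda}$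 (with value $\tau$ at $\lambda=0$). Then for all $\tau\in\mathbb{R}$ and all $g_1,g_2\in L^2(\mathbb{R})$, the following hold almost everywhere on $\mathbb{R}$: $$\bigl(\cos(\tau\bar p_\xi)g_1\bigr)(\xi)=\tfrac12\Bigl[g_1\bigl(\xi+\tfrac{\tau}{K}\bigr)+g_1\bigl(\xi-\tfrac{\tau}{K}\bigr)\Bigr],$$ $$\Bigl(\frac{\sin(\tau\bar p_\xi)}{\bar p_\xi}\,g_2\Bigr)(\xi)=\frac{K}{2}\,\operatorname{sgn}(\tau)\,\bigl(\chi_{[-|\tau|/K,\,|\tau|/K]}*g_2\bigr)(\xi),$$ where $\operatorname{sgn}=\chi_{(0,\infty)}-\chi_{(-\infty,0)}$, $\chi_S$ is the characteristic function of $S$, and the convolution integral $(\chi_{[-|\tau|/K,\,|\tau|/K]}*g_2)(\xi)=\int_{\mathbb{R}}\chi_{[-|\tau|/K,\,|\tau|/K]}(t)\,g_2(\xi-t)\,dt$ exists for every $\xi\in\mathbb{R}$. -/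

import Mathlib

open MeasureTheory
open scoped ContDiff InnerProductSpace Convolution

noncomputable section

/-- The Hilbert space `L²(ℝ; ℂ)` with respect to Lebesgue measure. -/
abbrev L2R : Type := Lp ℂ 2 (volume : Measure ℝ)

/-! ### Spectral measures and functions of a self-adjoint operator -/

section Spectral

variable {H : Type*} [NormedAddCommGroup H] [InnerProductSpace ℂ H] [CompleteSpace H]

/-- A spectral measure (projection-valued measure, resolution of the identity) on the Borel sets of
`ℝ` with values in the orthogonal projections of `H`. The values on non-measurable sets are
irrelevant and set to zero. -/
structure SpectralMeasure (H : Type*) [NormedAddCommGroup H] [InnerProductSpace ℂ H]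
    [CompleteSpace H] where
  /-- the projection attached to a set -/
  proj : Set ℝ → H →L[ℂ] H
  isStarProjection : ∀ s, MeasurableSet s → IsStarProjection (proj s)
  proj_univ : proj Set.univ = 1
  proj_inter : ∀ s t, MeasurableSet s → MeasurableSet t → proj (s ∩ t) = proj s * proj t
  hasSum_iUnion : ∀ s : ℕ → Set ℝ, (∀ n, MeasurableSet (s n)) →
    Pairwise (Function.onFun Disjoint s) →
      ∀ x : H, HasSum (fun n => proj (s n) x) (proj (⋃ n, s n) x)
  not_measurable : ∀ s, ¬ MeasurableSet s → proj s = 0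

namespace SpectralMeasure

theorem proj_empty (E : SpectralMeasure H) : E.proj ∅ = 0 := by
  ext x
  have h := E.hasSum_iUnion (fun _ => ∅) (fun _ => MeasurableSet.empty)
    (fun _ _ _ => by simp [Function.onFun]) x
  have h2 := h.summable.tendsto_atTop_zero
  simpa using tendsto_nhds_unique tendsto_const_nhds h2

theorem inner_proj_eq (E : SpectralMeasure H) {s : Set ℝ} (hs : MeasurableSet s) (x : H) :
    ⟪x, E.proj s x⟫_ℂ = ((‖E.proj s x‖ ^ 2 : ℝ) : ℂ) := by
  have hp := E.isStarProjection s hs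
  have h1 : E.proj s (E.proj s x) = E.proj s x := by
    have := hp.isIdempotentElem
    exact congrArg (fun T : H →L[ℂ] H => T x) this
  have h2 : ⟪E.proj s x, E.proj s x⟫_ℂ = ⟪x, E.proj s (E.proj s x)⟫_ℂ :=
    (ContinuousLinearMap.isSelfAdjoint_iff_isSymmetric.mp hp.isSelfAdjoint) x (E.proj s x)
  rw [h1] at h2
  rw [← h2, inner_self_eq_norm_sq_to_K]
  push_cast
  rfl

/-- The scalar measure `s ↦ ⟪x, E(s) x⟫` of a vector `x`. -/
def measure (E : SpectralMeasure H) (x : H) : Measure ℝ :=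
  Measure.ofMeasurable (fun s _ => ENNReal.ofReal (RCLike.re ⟪x, E.proj s x⟫_ℂ))
    (by simp [E.proj_empty])
    (by
      intro f hf hd
      have h0 : ∀ s, MeasurableSet s → 0 ≤ RCLike.re ⟪x, E.proj s x⟫_ℂ := by
        intro s hs
        rw [E.inner_proj_eq hs]
        simp only [RCLike.re_to_complex, Complex.ofReal_re]
        positivity
      have h1 : HasSum (fun n => RCLike.re ⟪x, E.proj (f n) x⟫_ℂ)
          (RCLike.re ⟪x, E.proj (⋃ n, f n) x⟫_ℂ) := by
        have := (E.hasSum_iUnion f hf hd x).mapL (innerSL ℂ x)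
        simpa using RCLike.hasSum_re ℂ this
      rw [← h1.tsum_eq, ENNReal.ofReal_tsum_of_nonneg (fun n => h0 _ (hf n)) h1.summable])

/-- `S` is the bounded operator `∫ f dE`: it is determined by `⟪x, S x⟫ = ∫ f d⟪x, E x⟫`.
To be used for bounded Borel functions `f`. -/
def IsIntegral (E : SpectralMeasure H) (f : ℝ → ℂ) (S : H →L[ℂ] H) : Prop :=
  ∀ x : H, ⟪x, S x⟫_ℂ = ∫ l, f l ∂(E.measure x)

/-- `E` is the spectral measure of the (possibly unbounded) operator `T`, that is
`T = ∫ l dE(l)`: the domain of `T` consists of all `x` with `∫ l² d⟪x, E(l) x⟫ < ∞`, and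
`⟪x, T x⟫ = ∫ l d⟪x, E(l) x⟫` for these `x`. By the spectral theorem, the operators that possess
a spectral measure are exactly the densely defined self-adjoint ones, and the spectral measure is
unique. -/
def IsSpectralMeasureOf (E : SpectralMeasure H) (T : H →ₗ.[ℂ] H) : Prop :=
  (∀ x : H, x ∈ T.domain ↔ Integrable (fun l : ℝ => l ^ 2) (E.measure x)) ∧
    ∀ x : T.domain, ⟪(x : H), T x⟫_ℂ = ∫ l : ℝ, (l : ℂ) ∂(E.measure (x : H))

end SpectralMeasure

/-- The bounded operator `f(T)` which the functional calculus of the self-adjoint operator `T`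
attaches to the bounded Borel function `f`: the integral of `f` with respect to the spectral
measure of `T`. (It is zero if `T` has no spectral measure, that is, if `T` is not
self-adjoint.) -/
def boundedFunction (T : H →ₗ.[ℂ] H) (f : ℝ → ℂ) : H →L[ℂ] H :=
  open Classical in
  if h : ∃ S : H →L[ℂ] H, ∃ E : SpectralMeasure H, E.IsSpectralMeasureOf T ∧ E.IsIntegral f S
  then h.choose else 0

/-- Two self-adjoint operators commute strongly if all their spectral projections commute.
The existence of the spectral measures (that is, self-adjointness) is part of the notion. -/
def StronglyCommute (T S : H →ₗ.[ℂ] H) : Prop :=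
  ∃ E F : SpectralMeasure H, E.IsSpectralMeasureOf T ∧ F.IsSpectralMeasureOf S ∧
    ∀ s t, MeasurableSet s → MeasurableSet t → Commute (E.proj s) (F.proj t)

/-- The square `T²` of an operator, with domain `{x ∈ D(T) | T x ∈ D(T)}`. -/
def squareOp (T : H →ₗ.[ℂ] H) : H →ₗ.[ℂ] H where
  domain := (T.domain.comap T.toFun).map T.domain.subtype
  toFun :=
    { toFun := fun x => T ⟨T ⟨x.1, by
          obtain ⟨y, -, hy⟩ := x.2; rw [← hy]; exact y.2⟩, by
          obtain ⟨y, hy, hyx⟩ := x.2; simp only [← hyx]; exact hy⟩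
      map_add' := fun x y => by
        rw [← LinearPMap.map_add]
        congr 1
        ext
        simp only [Submodule.coe_add]
        rw [← LinearPMap.map_add]
        rfl
      map_smul' := fun c x => by
        rw [RingHom.id_apply, ← LinearPMap.map_smul]
        congr 1
        ext
        simp only [Submodule.coe_smul]
        rw [← LinearPMap.map_smul]
        rfl }

end Spectral

/-! ### The operators -/

/-- The space `C₀^∞(ℝ, ℂ)` of smooth compactly supported functions. -/
def testSpace : Submodule ℂ (ℝ → ℂ) where
  carrier := {f | ContDiff ℝ ∞ f ∧ HasCompactSupport f}
  add_mem' := fun hf hg => ⟨hf.1.add hg.1, hf.2.add hg.2⟩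
  zero_mem' := ⟨contDiff_const, HasCompactSupport.zero⟩
  smul_mem' := fun c _ hf => ⟨hf.1.const_smul c, hf.2.smul_left (f := fun _ => c)⟩

theorem testSpace_memLp (f : testSpace) : MemLp (f : ℝ → ℂ) 2 (volume : Measure ℝ) :=
  f.2.1.continuous.memLp_of_hasCompactSupport f.2.2

/-- The inclusion of `C₀^∞(ℝ, ℂ)` into `L²(ℝ; ℂ)`. -/
def testToL2 : testSpace →ₗ[ℂ] L2R where
  toFun f := (testSpace_memLp f).toLp f
  map_add' _ _ := rfl
  map_smul' _ _ := rfl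

theorem testToL2_injective : Function.Injective testToL2 := by
  intro f g h
  have h1 : (f : ℝ → ℂ) =ᵐ[volume] g :=
    (MemLp.toLp_eq_toLp_iff (testSpace_memLp f) (testSpace_memLp g)).mp h
  exact Subtype.ext ((f.2.1.continuous.ae_eq_iff_eq volume g.2.1.continuous).mp h1)

/-- The derivative `f ↦ f'` on `C₀^∞(ℝ, ℂ)`. -/
def testDeriv : testSpace →ₗ[ℂ] testSpace where
  toFun f := ⟨deriv f, (contDiff_infty_iff_deriv.mp f.2.1).2, f.2.2.deriv⟩
  map_add' f g := by
    ext x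
    exact deriv_add ((contDiff_infty_iff_deriv.mp f.2.1).1 x)
      ((contDiff_infty_iff_deriv.mp g.2.1).1 x)
  map_smul' c f := by
    ext x
    exact deriv_const_smul c ((contDiff_infty_iff_deriv.mp f.2.1).1 x)

/-- A linear map `L` on `C₀^∞(ℝ, ℂ)`, regarded as an operator in `L²(ℝ; ℂ)` with domain
`C₀^∞(ℝ, ℂ)`. -/
def testOperator (L : testSpace →ₗ[ℂ] testSpace) : L2R →ₗ.[ℂ] L2R where
  domain := LinearMap.range testToL2
  toFun := testToL2 ∘ₗ L ∘ₗ (LinearEquiv.ofInjective testToL2 testToL2_injective).symm.toLinearMap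

/-- The operator `f ↦ (i / K) f'` with domain `C₀^∞(ℝ, ℂ)`. -/
def momentum₀ (K : ℝ) : L2R →ₗ.[ℂ] L2R :=
  testOperator ((Complex.I / (K : ℂ)) • testDeriv)

/-- The closure of `momentum₀ K`. -/
def momentum (K : ℝ) : L2R →ₗ.[ℂ] L2R := (momentum₀ K).closure

/-- The operator `f ↦ -(1 / K²) f''` with domain `C₀^∞(ℝ, ℂ)`. -/
def waveOp₀ (K : ℝ) : L2R →ₗ.[ℂ] L2R :=
  testOperator ((-(1 / (K : ℂ) ^ 2)) • (testDeriv ∘ₗ testDeriv))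

/-- The closure of `waveOp₀ K`. -/
def waveOp (K : ℝ) : L2R →ₗ.[ℂ] L2R := (waveOp₀ K).closure

/-- The continuous function `l ↦ sin(τ l) / l`, with its value `τ` at `l = 0`. -/
def sinDivId (τ l : ℝ) : ℝ := if l = 0 then τ else Real.sin (τ * l) / l

/-- The characteristic function of `s`, with complex values. -/
def charFn (s : Set ℝ) : ℝ → ℂ := s.indicator 1

end

/-! The Fourier transform turns everything into multiplication by real functions. With the kernel
`exp (-2πixw)`, the operator `(i/K) d/dξ` becomes multiplication by `m w = -2πw/K`, and `-(1/K²)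
d²/dξ²` becomes multiplication by `m²`. The main point is that the closures from `C₀^∞` are the
maximal multiplication operators (`closure_testOperator_eq_multiplier`). Cutoffs put the graph on
Schwartz functions into the closure of the graph on test functions. Since `m` is smooth and real,
division by `m + i` preserves test functions on the Fourier side, so the Schwartz graph is already
dense in the maximal one.

For maximal multiplication operators, the square of multiplication by `m` is multiplication by `m²`.
The spectral projections are multiplications by indicators of preimages under `m`. Any two
multiplication operators over the same unitary therefore commute strongly.

For the functional calculus, `boundedFunction` picks some operator arising from some spectral
measure, so uniqueness of the spectral measure is needed (`multiplierSpectralMeasure_proj_eq_self`,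
`measure_eq_of_proj_Icc`). Powers of `T - c` grow at most like `r ^ n` on the range of `E [c - r, c
+ r]`, and faster on any component spectrally supported farther than `r` from `c`. It follows that
`f(T)` is multiplication by `f ∘ m` (`boundedFunction_multiplier`).

Finally, translation by `a` is multiplication by `exp (2πiaw)`. Thus `cos (τ m)` is the mean of two
translations, and `sin (τ m) / m` is a multiple of the integral of translations over `[-|τ|/K,
|τ|/K]`, which is the stated convolution. -/

/-! ### Spectral measures and the operators they represent -/

namespace SpectralMeasure

variable {H : Type*} [NormedAddCommGroup H] [InnerProductSpace ℂ H] [CompleteSpace H]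
  (E : SpectralMeasure H)

theorem proj_proj {s t : Set ℝ} (hs : MeasurableSet s) (ht : MeasurableSet t) (x : H) :
    E.proj s (E.proj t x) = E.proj (s ∩ t) x := by
  rw [E.proj_inter s t hs ht]; rfl

theorem proj_inner_left {s : Set ℝ} (hs : MeasurableSet s) (x y : H) :
    ⟪E.proj s x, y⟫_ℂ = ⟪x, E.proj s y⟫_ℂ :=
  (ContinuousLinearMap.isSelfAdjoint_iff_isSymmetric.mp (E.isStarProjection s hs).isSelfAdjoint) x y

theorem proj_add_proj_compl {s : Set ℝ} (hs : MeasurableSet s) (x : H) :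
    E.proj s x + E.proj sᶜ x = x := by
  have h := E.hasSum_iUnion (fun n => if n = 0 then s else if n = 1 then sᶜ else ∅)
    (by intro n; split_ifs <;> simp [hs])
    (by
      intro i j hij
      simp only [Function.onFun]
      split_ifs <;> simp_all [disjoint_compl_right, disjoint_compl_left]) x
  have hU : (⋃ n : ℕ, if n = 0 then s else if n = 1 then sᶜ else ∅) = Set.univ := by
    refine Set.eq_univ_of_forall fun l => Set.mem_iUnion.mpr ?_
    by_cases hl : l ∈ s
    · exact ⟨0, by simpa using hl⟩
    · exact ⟨1, by simpa using hl⟩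
  rw [hU, E.proj_univ] at h
  have h2 := hasSum_sum_of_ne_finset_zero (L := SummationFilter.unconditional ℕ)
    (s := Finset.range 2)
    (f := fun n : ℕ => E.proj (if n = 0 then s else if n = 1 then sᶜ else ∅) x) (by
      intro b hb
      have h0 : b ≠ 0 := by rintro rfl; simp at hb
      have h1 : b ≠ 1 := by rintro rfl; simp at hb
      simp [h0, h1, E.proj_empty])
  have := HasSum.unique (L := SummationFilter.unconditional ℕ) h2 h
  simpa [Finset.sum_range_succ] using this

theorem measure_apply (x : H) {s : Set ℝ} (hs : MeasurableSet s) :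
    E.measure x s = ENNReal.ofReal (RCLike.re ⟪x, E.proj s x⟫_ℂ) :=
  Measure.ofMeasurable_apply s hs

theorem measure_apply' (x : H) {s : Set ℝ} (hs : MeasurableSet s) :
    E.measure x s = ENNReal.ofReal (‖E.proj s x‖ ^ 2) := by
  rw [E.measure_apply x hs, E.inner_proj_eq hs]
  rfl

theorem measure_univ (x : H) : E.measure x Set.univ = ENNReal.ofReal (‖x‖ ^ 2) := by
  rw [E.measure_apply' x MeasurableSet.univ, E.proj_univ]; rfl

instance (x : H) : IsFiniteMeasure (E.measure x) :=
  ⟨by rw [E.measure_univ]; exact ENNReal.ofReal_lt_top⟩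

theorem measure_eq_zero_iff (x : H) {s : Set ℝ} (hs : MeasurableSet s) :
    E.measure x s = 0 ↔ E.proj s x = 0 := by
  rw [E.measure_apply' x hs, ENNReal.ofReal_eq_zero]
  constructor
  · intro h
    have : ‖E.proj s x‖ ^ 2 = 0 := le_antisymm h (by positivity)
    simpa using this
  · intro h; simp [h]

theorem measure_proj (x : H) {s : Set ℝ} (hs : MeasurableSet s) :
    E.measure (E.proj s x) = (E.measure x).restrict s := by
  ext t ht
  rw [Measure.restrict_apply ht, E.measure_apply' _ ht, E.measure_apply' _ (ht.inter hs),
    E.proj_proj ht hs]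

/-- The cross terms `⟪u, E(t) v⟫` vanish because `s ∩ (t ∩ sᶜ)` is empty. -/
theorem measure_add {s : Set ℝ} (hs : MeasurableSet s) {u v : H} (hu : E.proj s u = u)
    (hv : E.proj sᶜ v = v) : E.measure (u + v) = E.measure u + E.measure v := by
  have key : ∀ t, MeasurableSet t → ⟪u, E.proj t v⟫_ℂ = 0 := by
    intro t ht
    rw [← hu, ← hv, E.proj_inner_left hs, E.proj_proj ht hs.compl, E.proj_proj hs (ht.inter hs.compl)]
    have : s ∩ (t ∩ sᶜ) = ∅ := by ext; simp; tauto
    rw [this, E.proj_empty]; simp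
  ext t ht
  have h1 := key t ht
  have h2 : ⟪v, E.proj t u⟫_ℂ = 0 := by
    rw [← E.proj_inner_left ht, ← inner_conj_symm, h1, map_zero]
  rw [Measure.add_apply, E.measure_apply _ ht, E.measure_apply _ ht, E.measure_apply _ ht, map_add,
    inner_add_left, inner_add_right, inner_add_right, h1, h2, add_zero, zero_add, map_add,
    ENNReal.ofReal_add]
  all_goals rw [E.inner_proj_eq ht]; simp only [RCLike.re_to_complex, Complex.ofReal_re]; positivity

namespace IsSpectralMeasureOf

variable {E} {T : H →ₗ.[ℂ] H} (hE : E.IsSpectralMeasureOf T)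
include hE

theorem mem_domain_proj_Icc (a b : ℝ) (x : H) : E.proj (Set.Icc a b) x ∈ T.domain := by
  rw [hE.1, E.measure_proj x measurableSet_Icc]
  exact (continuous_pow 2).continuousOn.integrableOn_compact isCompact_Icc

theorem integrable_id (x : T.domain) : Integrable (fun l : ℝ => (l : ℂ)) (E.measure (x : H)) := by
  refine Integrable.ofReal (f := fun l : ℝ => l) ?_
  refine ((integrable_const (1 : ℝ)).add ((hE.1 x).mp x.2)).mono'
    (by fun_prop) (.of_forall fun l => ?_)
  simp only [Pi.add_apply, Real.norm_eq_abs]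
  exact abs_le.mpr ⟨by nlinarith [sq_nonneg (l + 1)], by nlinarith [sq_nonneg (l - 1)]⟩

/-- Only the quadratic form of `T` is known, so this is polarization. Additivity of the measures
kills the sum of the cross terms for `u + v` and for `u + i v`, and the two relations together give
`2 ⟪v, T u⟫ = 0`. -/
theorem inner_orthogonal {s : Set ℝ} (hs : MeasurableSet s) (u v : T.domain)
    (hu : E.proj s u = u) (hv : E.proj sᶜ v = v) : ⟪(v : H), T u⟫_ℂ = 0 := by
  have key : ∀ w : T.domain, E.proj sᶜ w = w → ⟪(u : H), T w⟫_ℂ + ⟪(w : H), T u⟫_ℂ = 0 := by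
    intro w hw
    have h1 := hE.2 (u + w)
    rw [Submodule.coe_add, E.measure_add hs hu hw, integral_add_measure (hE.integrable_id u)
      (hE.integrable_id w), ← hE.2, ← hE.2, LinearPMap.map_add, inner_add_left, inner_add_right,
      inner_add_right] at h1
    linear_combination h1
  have h1 := key v hv
  have h2 := key (Complex.I • v) (by simp [hv])
  rw [LinearPMap.map_smul, Submodule.coe_smul, inner_smul_left, inner_smul_right] at h2
  simp only [Complex.conj_I] at h2
  have h3 : Complex.I * (2 * ⟪(v : H), T u⟫_ℂ) = 0 := by linear_combination Complex.I * h1 - h2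
  simpa using h3

/-- Spectral subspaces are invariant. The component `y` of `T u` in the range of `E(sᶜ)` need not
lie in the domain, but its truncations to `[-n, n]` do. They are orthogonal to `T u` by
`inner_orthogonal`, so the measure of `y` vanishes on each `[-n, n]`. -/
theorem proj_apply {s : Set ℝ} (hs : MeasurableSet s) (u : T.domain)
    (hu : E.proj s u = u) : E.proj s (T u) = T u := by
  have hy : E.proj sᶜ (T u) = 0 := by
    set y := E.proj sᶜ (T u) with hy
    have h1 : ∀ n : ℕ, E.measure y (Set.Icc (-(n : ℝ)) n) = 0 := by
      intro n
      rw [E.measure_apply _ measurableSet_Icc]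
      set z := E.proj (Set.Icc (-(n : ℝ)) n) y with hz
      have hz' : z ∈ T.domain := hE.mem_domain_proj_Icc _ _ _
      have hzs : E.proj sᶜ z = z := by
        rw [hz, hy, E.proj_proj hs.compl measurableSet_Icc, E.proj_proj measurableSet_Icc hs.compl,
          E.proj_proj (hs.compl.inter measurableSet_Icc) hs.compl]
        congr 2; ext; simp; tauto
      have := hE.inner_orthogonal hs u ⟨z, hz'⟩ hu hzs
      have h2 : ⟪y, z⟫_ℂ = 0 := by
        rw [hy, E.proj_inner_left hs.compl, hzs, ← inner_conj_symm]
        rw [this, map_zero]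
      rw [h2]; simp
    have h2 : E.measure y (⋃ n : ℕ, Set.Icc (-(n : ℝ)) n) = 0 := measure_iUnion_null h1
    have h3 : (⋃ n : ℕ, Set.Icc (-(n : ℝ)) n) = Set.univ := by
      refine Set.eq_univ_of_forall fun l => Set.mem_iUnion.mpr ?_
      obtain ⟨n, hn⟩ := exists_nat_ge |l|
      exact ⟨n, abs_le.mp hn⟩
    rw [h3, E.measure_eq_zero_iff _ MeasurableSet.univ, E.proj_univ] at h2
    simpa using h2
  have := E.proj_add_proj_compl hs (T u)
  rwa [hy, add_zero] at this

theorem norm_inner_sub_le {c r : ℝ} (u : T.domain)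
    (hu : E.proj (Set.Icc (c - r) (c + r)) u = u) :
    ‖⟪(u : H), T u - (c : ℂ) • (u : H)⟫_ℂ‖ ≤ r * ‖(u : H)‖ ^ 2 := by
  have h1 : ⟪(u : H), T u - (c : ℂ) • (u : H)⟫_ℂ = ∫ l : ℝ, ((l : ℂ) - c) ∂(E.measure (u : H)) := by
    rw [integral_sub (hE.integrable_id u) (integrable_const _), ← hE.2, inner_sub_right,
      inner_smul_right, integral_const, inner_self_eq_norm_sq_to_K, Measure.real, E.measure_univ,
      ENNReal.toReal_ofReal (by positivity), mul_comm]
    simp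
  have hm : (E.measure (u : H)).real Set.univ = ‖(u : H)‖ ^ 2 := by
    rw [Measure.real, E.measure_univ, ENNReal.toReal_ofReal (by positivity)]
  rw [h1, ← hm]
  refine norm_integral_le_of_norm_le_const ?_
  rw [← hu, E.measure_proj _ measurableSet_Icc]
  filter_upwards [ae_restrict_mem measurableSet_Icc] with l hl
  rw [← Complex.ofReal_sub, Complex.norm_real, Real.norm_eq_abs, abs_le]
  constructor <;> linarith [hl.1, hl.2]

/-- The numerical radius of a symmetric operator bounds its norm. `S = T - c` maps the spectral
subspace to itself and has a real quadratic form there, hence is symmetric. Polarization of `⟪w, S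
u⟫` and the parallelogram law then upgrade the bound on the form. -/
theorem norm_sub_le {c r : ℝ} (u : T.domain)
    (hu : E.proj (Set.Icc (c - r) (c + r)) u = u) :
    ‖T u - (c : ℂ) • (u : H)‖ ≤ r * ‖(u : H)‖ := by
  set S : T.domain →ₗ[ℂ] H := T.toFun - (c : ℂ) • T.domain.subtype with hS
  have hSa : ∀ w : T.domain, S w = T w - (c : ℂ) • (w : H) := fun w => rfl
  have hq : ∀ w : T.domain, E.proj (Set.Icc (c - r) (c + r)) w = w →
      ‖⟪(w : H), S w⟫_ℂ‖ ≤ r * ‖(w : H)‖ ^ 2 := fun w hw => by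
    rw [hSa]; exact hE.norm_inner_sub_le w hw
  have hVS : E.proj (Set.Icc (c - r) (c + r)) (S u) = S u := by
    rw [hSa, map_sub, map_smul, hu, hE.proj_apply measurableSet_Icc u hu]
  rw [← hSa]
  have hdom : S u ∈ T.domain := hVS ▸ hE.mem_domain_proj_Icc _ _ _
  by_cases h0 : S u = 0
  · rw [h0, norm_zero]
    by_cases hu0 : (u : H) = 0
    · simp [hu0]
    · have := (norm_nonneg _).trans (hq u hu)
      have hp : 0 < ‖(u : H)‖ := norm_pos_iff.mpr hu0
      nlinarith
  have hpos : 0 < ‖S u‖ := norm_pos_iff.mpr h0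
  have hupos : 0 < ‖(u : H)‖ := by
    rw [norm_pos_iff]; rintro h
    exact h0 (by rw [show u = 0 from Subtype.ext h, map_zero])
  -- This scaling gives `‖w‖ = ‖u‖` and `⟪w, S u⟫ = ‖u‖ ‖S u‖`, so the parallelogram law yields
  -- exactly `4 ‖u‖ ‖S u‖ ≤ 4 r ‖u‖ ^ 2`.
  set t : ℝ := ‖(u : H)‖ / ‖S u‖ with ht
  set w : T.domain := (t : ℂ) • ⟨S u, hdom⟩ with hw
  have hwV : E.proj (Set.Icc (c - r) (c + r)) w = w := by
    rw [hw, Submodule.coe_smul, map_smul]; simp only; rw [hVS]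
  have e1 := hq (w + u) (by simp [hwV, hu])
  have e2 := hq (w - u) (by simp [hwV, hu])
  have hsym : ⟪(u : H), S w⟫_ℂ = (starRingEnd ℂ) ⟪(w : H), S u⟫_ℂ := by
    have hreal : ∀ z : T.domain, (starRingEnd ℂ) ⟪(z : H), T z⟫_ℂ = ⟪(z : H), T z⟫_ℂ := by
      intro z
      rw [hE.2, ← integral_conj]; simp
    have hrealS : ∀ z : T.domain, (starRingEnd ℂ) ⟪(z : H), S z⟫_ℂ = ⟪(z : H), S z⟫_ℂ := by
      intro z
      rw [hSa, inner_sub_right, map_sub, hreal, inner_smul_right, map_mul, inner_conj_symm]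
      simp
    have a1 := hrealS (u + w)
    have a2 := hrealS (u + Complex.I • w)
    simp only [map_add, map_smul, Submodule.coe_add, Submodule.coe_smul, inner_add_left,
      inner_add_right, inner_smul_left, inner_smul_right, map_mul, Complex.conj_I, map_neg,
      hrealS] at a1 a2
    have := Complex.I_mul_I
    have a3 : Complex.I * ((2 : ℂ) * (⟪(u : H), S w⟫_ℂ - (starRingEnd ℂ) ⟪(w : H), S u⟫_ℂ)) = 0 := by
      linear_combination -a2 - Complex.I * a1
    have a4 := (mul_eq_zero.mp a3).resolve_left Complex.I_ne_zero
    have a5 := (mul_eq_zero.mp a4).resolve_left two_ne_zero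
    exact sub_eq_zero.mp a5
  have hws : ⟪(w : H), S u⟫_ℂ = ((t * ‖S u‖ ^ 2 : ℝ) : ℂ) := by
    rw [hw, Submodule.coe_smul, inner_smul_left]
    simp only
    rw [inner_self_eq_norm_sq_to_K]; simp
  have hpol : ⟪((w + u : T.domain) : H), S (w + u)⟫_ℂ - ⟪((w - u : T.domain) : H), S (w - u)⟫_ℂ
      = ((4 * (t * ‖S u‖ ^ 2) : ℝ) : ℂ) := by
    simp only [map_add, map_sub, Submodule.coe_add, Submodule.coe_sub, inner_add_left,
      inner_add_right, inner_sub_left, inner_sub_right, hsym, hws, Complex.conj_ofReal]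
    push_cast; ring
  have hn := _root_.norm_sub_le ⟪((w + u : T.domain) : H), S (w + u)⟫_ℂ ⟪((w - u : T.domain) : H), S (w - u)⟫_ℂ
  rw [hpol, Complex.norm_real, Real.norm_of_nonneg (by positivity)] at hn
  have hpar := parallelogram_law_with_norm ℂ (w : H) (u : H)
  simp only [Submodule.coe_add, Submodule.coe_sub] at e1 e2 hn
  have hwn : ‖(w : H)‖ = ‖(u : H)‖ := by
    rw [hw, Submodule.coe_smul, norm_smul, Complex.norm_real, Real.norm_of_nonneg (by positivity), ht]
    simp only
    field_simp
  have hts : t * ‖S u‖ ^ 2 = ‖(u : H)‖ * ‖S u‖ := by rw [ht]; field_simp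
  rw [hwn] at hpar
  rw [hts] at hn
  have hfin : ‖(u : H)‖ * ‖S u‖ ≤ ‖(u : H)‖ * (r * ‖(u : H)‖) := by
    linear_combination (1 / 4) * (hn + e1 + e2 + r * hpar)
  exact le_of_mul_le_mul_left hfin hupos

end IsSpectralMeasureOf

end SpectralMeasure

set_option linter.unusedSectionVars false

noncomputable section

open Filter Topology ENNReal

/-! ### Multiplication operators and their spectral measures -/

section Multiplication

variable {H : Type*} [NormedAddCommGroup H] [InnerProductSpace ℂ H] [CompleteSpace H]
  {α : Type*} [MeasurableSpace α] {μ : Measure α}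

theorem norm_sq_L2_eq_integral (g : Lp ℂ 2 μ) : ‖g‖ ^ 2 = ∫ a, ‖g a‖ ^ 2 ∂μ := by
  have h := congrArg RCLike.re (inner_self_eq_norm_sq_to_K (𝕜 := ℂ) g)
  rw [L2.inner_def] at h
  simp only [inner_self_eq_norm_sq_to_K] at h
  have h2 : (∫ a, ((‖g a‖ : ℂ)) ^ 2 ∂μ) = ((∫ a, ‖g a‖ ^ 2 ∂μ : ℝ) : ℂ) := by
    rw [← integral_complex_ofReal]; simp
  have h3 : ((‖g‖ : ℂ) ^ 2) = ((‖g‖ ^ 2 : ℝ) : ℂ) := by push_cast; rfl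
  erw [h2, h3] at h
  exact h.symm

theorem integrable_norm_sq_L2 (g : Lp ℂ 2 μ) : Integrable (fun a => ‖g a‖ ^ 2) μ := by
  have := (memLp_two_iff_integrable_sq_norm (Lp.memLp g).1).mp (Lp.memLp g)
  exact this

/-- Dominated convergence for uniformly bounded multipliers in `L²`. -/
theorem tendsto_L2_of_bounded_multiplier {ι : Type*} {l : Filter ι} [l.IsCountablyGenerated]
    (h : Lp ℂ 2 μ) (φ : ι → α → ℂ) (ψ : α → ℂ) (C : ℝ) (hC : ∀ i a, ‖φ i a‖ ≤ C)
    (hφ : ∀ a, Tendsto (fun i => φ i a) l (𝓝 (ψ a))) (hC' : ∀ a, ‖ψ a‖ ≤ C)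
    (G : ι → Lp ℂ 2 μ) (g : Lp ℂ 2 μ)
    (hG : ∀ i, G i =ᵐ[μ] fun a => φ i a * h a) (hg : g =ᵐ[μ] fun a => ψ a * h a) :
    Tendsto G l (𝓝 g) := by
  rw [tendsto_iff_norm_sub_tendsto_zero]
  have hsub : ∀ i, (G i - g : Lp ℂ 2 μ) =ᵐ[μ] fun a => (φ i a - ψ a) * h a := fun i => by
    filter_upwards [Lp.coeFn_sub (G i) g, hG i, hg] with a h1 h2 h3
    rw [h1, Pi.sub_apply, h2, h3]; ring
  have key : Tendsto (fun i => ‖G i - g‖ ^ 2) l (𝓝 0) := by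
    have e : ∀ i, ‖G i - g‖ ^ 2 = ∫ a, ‖(φ i a - ψ a) * h a‖ ^ 2 ∂μ := fun i => by
      rw [norm_sq_L2_eq_integral]
      apply integral_congr_ae
      filter_upwards [hsub i] with a ha
      rw [ha]
    simp_rw [e]
    rw [← integral_zero α ℝ (μ := μ)]
    refine tendsto_integral_filter_of_dominated_convergence (fun a => (2 * C) ^ 2 * ‖h a‖ ^ 2)
      (.of_forall fun i => (integrable_norm_sq_L2 (G i - g)).1.congr ?_)
      (.of_forall fun i => .of_forall fun a => ?_)
      ((integrable_norm_sq_L2 h).const_mul _) (.of_forall fun a => ?_)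
    · filter_upwards [hsub i] with a ha
      rw [ha]
    · rw [norm_mul, mul_pow, Real.norm_of_nonneg (by positivity)]
      gcongr
      calc ‖φ i a - ψ a‖ ≤ ‖φ i a‖ + ‖ψ a‖ := norm_sub_le _ _
        _ ≤ 2 * C := by linarith [hC i a, hC' a]
    · have := ((((hφ a).sub_const (ψ a)).mul_const (h a)).norm).pow 2
      simpa using this
  have := key.sqrt
  simpa using this

/-- The bounded operator that multiplication by `f` induces through the unitary `U`. -/
def multiplierCLM (U : H ≃ₗᵢ[ℂ] Lp ℂ 2 μ) (f : α → ℂ) (hf : MemLp f ∞ μ) : H →L[ℂ] H :=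
  (U.symm.toContinuousLinearEquiv : Lp ℂ 2 μ →L[ℂ] H) ∘L
    ((ContinuousLinearMap.mul ℂ ℂ).holderL μ ∞ 2 2 (hf.toLp f)) ∘L
    (U.toContinuousLinearEquiv : H →L[ℂ] Lp ℂ 2 μ)

variable (U : H ≃ₗᵢ[ℂ] Lp ℂ 2 μ)

theorem multiplierCLM_ae {f : α → ℂ} (hf : MemLp f ∞ μ) (x : H) :
    U (multiplierCLM U f hf x) =ᵐ[μ] fun a => f a * U x a := by
  have : U (multiplierCLM U f hf x) =
      (ContinuousLinearMap.mul ℂ ℂ).holder 2 (hf.toLp f) (U x) := by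
    simp [multiplierCLM]
  rw [this]
  filter_upwards [(ContinuousLinearMap.mul ℂ ℂ).coeFn_holder (r := 2) (hf.toLp f) (U x),
    hf.coeFn_toLp] with a h1 h2
  rw [h1, h2]; rfl

theorem inner_eq_integral (x y : H) :
    ⟪x, y⟫_ℂ = ∫ a, U y a * (starRingEnd ℂ) (U x a) ∂μ := by
  rw [← U.inner_map_map, L2.inner_def]
  rfl

theorem memLp_indicator_one {s : Set α} (hs : MeasurableSet s) :
    MemLp (s.indicator (1 : α → ℂ)) ∞ μ :=
  memLp_top_of_bound (measurable_one.indicator hs).aestronglyMeasurable 1 (.of_forall fun a => by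
    by_cases h : a ∈ s <;> simp [h])

variable {m : α → ℝ} (hm : Measurable m)

open Classical in
/-- The spectral measure of multiplication by the real function `m`, transported by the
unitary `U`. -/
def multiplierSpectralMeasure : SpectralMeasure H where
  proj s := if hs : MeasurableSet s then
    multiplierCLM U ((m ⁻¹' s).indicator 1) (memLp_indicator_one (hm hs)) else 0
  isStarProjection s hs := by
    rw [dif_pos hs]
    refine ⟨?_, ?_⟩
    · ext x
      apply U.injective
      apply Lp.ext
      rw [mul_apply_eq_comp]
      filter_upwards [multiplierCLM_ae U (memLp_indicator_one (hm hs)) x,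
        multiplierCLM_ae U (memLp_indicator_one (hm hs))
          (multiplierCLM U ((m ⁻¹' s).indicator 1) (memLp_indicator_one (hm hs)) x)] with a h1 h2
      rw [h2, h1]
      by_cases h : a ∈ m ⁻¹' s <;> simp [h]
    · rw [ContinuousLinearMap.isSelfAdjoint_iff_isSymmetric]
      intro x y
      rw [ContinuousLinearMap.coe_coe, inner_eq_integral U, inner_eq_integral U]
      apply integral_congr_ae
      filter_upwards [multiplierCLM_ae U (memLp_indicator_one (hm hs)) x,
        multiplierCLM_ae U (memLp_indicator_one (hm hs)) y] with a h1 h2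
      rw [h1, h2]
      by_cases h : a ∈ m ⁻¹' s <;> simp [h]
  proj_univ := by
    rw [dif_pos MeasurableSet.univ]
    ext x
    apply U.injective
    apply Lp.ext
    filter_upwards [multiplierCLM_ae U (memLp_indicator_one (hm MeasurableSet.univ)) x] with a h1
    rw [h1]; simp
  proj_inter s t hs ht := by
    rw [dif_pos hs, dif_pos ht, dif_pos (hs.inter ht)]
    ext x
    apply U.injective
    apply Lp.ext
    rw [mul_apply_eq_comp]
    filter_upwards [multiplierCLM_ae U (memLp_indicator_one (hm (hs.inter ht))) x,
      multiplierCLM_ae U (memLp_indicator_one (hm ht)) x,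
      multiplierCLM_ae U (memLp_indicator_one (hm hs))
        (multiplierCLM U ((m ⁻¹' t).indicator 1) (memLp_indicator_one (hm ht)) x)] with a h1 h2 h3
    rw [h3, h2, h1]
    by_cases h : m a ∈ s <;> by_cases h' : m a ∈ t <;> simp [h, h']
  hasSum_iUnion s hs hd x := by
    rw [dif_pos (MeasurableSet.iUnion hs)]
    simp_rw [dif_pos (hs _)]
    have hU : Isometry U := U.isometry
    rw [HasSum, SummationFilter.unconditional_filter, hU.isEmbedding.isInducing.tendsto_nhds_iff]
    -- By disjointness the partial sums are again indicators, hence bounded by `1`. Strong countable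
    -- additivity is then dominated convergence.
    have hsum : ∀ (F : Finset ℕ) (a : α), ∑ i ∈ F, (m ⁻¹' s i).indicator (1 : α → ℂ) a =
        (⋃ i ∈ F, m ⁻¹' s i).indicator 1 a := by
      intro F a
      rw [Finset.indicator_biUnion]
      intro i _ j _ hij
      exact (hd hij).preimage m
    refine tendsto_L2_of_bounded_multiplier (U x)
      (fun F a => ∑ i ∈ F, (m ⁻¹' s i).indicator (1 : α → ℂ) a)
      ((m ⁻¹' ⋃ n, s n).indicator 1) 1 ?_ ?_ ?_ _ _ ?_ (multiplierCLM_ae U _ x)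
    · intro F a
      rw [hsum]
      by_cases h : a ∈ ⋃ i ∈ F, m ⁻¹' s i <;> simp only [h, Set.indicator_of_mem,
        Set.indicator_of_notMem, not_false_eq_true] <;> simp
    · intro a
      by_cases h : a ∈ m ⁻¹' ⋃ n, s n
      · obtain ⟨n, hn⟩ := Set.mem_iUnion.mp h
        refine tendsto_const_nhds.congr' ?_
        filter_upwards [eventually_ge_atTop {n}] with F hF
        rw [hsum, Set.indicator_of_mem h, Set.indicator_of_mem]
        simp only [Set.mem_iUnion]
        exact ⟨n, hF (Finset.mem_singleton_self n), hn⟩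
      · refine tendsto_const_nhds.congr fun F => ?_
        rw [hsum, Set.indicator_of_notMem h, Set.indicator_of_notMem]
        intro h'
        simp only [Set.mem_iUnion] at h'
        obtain ⟨n, _, hn⟩ := h'
        exact h (Set.mem_iUnion.mpr ⟨n, hn⟩)
    · intro a
      by_cases h : a ∈ m ⁻¹' ⋃ n, s n <;> simp only [h, Set.indicator_of_mem,
        Set.indicator_of_notMem, not_false_eq_true] <;> simp
    · intro F
      simp only [Function.comp_apply, map_sum]
      have h1 : ∀ᵐ a ∂μ, ∀ i, U (multiplierCLM U ((m ⁻¹' s i).indicator 1)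
          (memLp_indicator_one (hm (hs i))) x) a = (m ⁻¹' s i).indicator 1 a * U x a :=
        ae_all_iff.mpr fun i => multiplierCLM_ae U _ x
      filter_upwards [h1, Lp.coeFn_finsetSum F (fun i => U (multiplierCLM U
        ((m ⁻¹' s i).indicator 1) (memLp_indicator_one (hm (hs i))) x))] with a h2 h3
      rw [h3, Finset.sum_apply, Finset.sum_mul]
      exact Finset.sum_congr rfl fun i _ => h2 i
  not_measurable s hs := dif_neg hs

theorem multiplierSpectralMeasure_proj {s : Set ℝ} (hs : MeasurableSet s) :
    (multiplierSpectralMeasure U hm).proj s =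
      multiplierCLM U ((m ⁻¹' s).indicator 1) (memLp_indicator_one (hm hs)) :=
  dif_pos hs

theorem multiplierSpectralMeasure_proj_ae {s : Set ℝ} (hs : MeasurableSet s) (x : H) :
    U ((multiplierSpectralMeasure U hm).proj s x) =ᵐ[μ]
      fun a => (m ⁻¹' s).indicator 1 a * U x a := by
  rw [multiplierSpectralMeasure_proj U hm hs]
  exact multiplierCLM_ae U _ x

/-- `‖E(s) x‖ ^ 2` is the integral of `|U x|²` over `m ⁻¹' s`. Integrals against the spectral
measure thereby become integrals over `α`. -/
theorem multiplierSpectralMeasure_measure (x : H) :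
    (multiplierSpectralMeasure U hm).measure x =
      (μ.withDensity fun a => (‖U x a‖₊ ^ 2 : NNReal)).map m := by
  ext s hs
  rw [SpectralMeasure.measure_apply' _ _ hs, Measure.map_apply hm hs, withDensity_apply _ (hm hs),
    ← U.norm_map, norm_sq_L2_eq_integral, ofReal_integral_eq_lintegral_ofReal
      (integrable_norm_sq_L2 _) (.of_forall fun _ => by positivity), ← lintegral_indicator (hm hs)]
  apply lintegral_congr_ae
  filter_upwards [multiplierSpectralMeasure_proj_ae U hm hs x] with a ha
  rw [ha]
  by_cases h : a ∈ m ⁻¹' s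
  · simp [h, ← enorm_eq_nnnorm, ENNReal.ofReal_pow, ofReal_norm]
  · simp [h]

theorem aemeasurable_nnnorm_sq (g : Lp ℂ 2 μ) : AEMeasurable (fun a => ‖g a‖₊ ^ 2) μ :=
  ((Lp.aestronglyMeasurable g).aemeasurable.nnnorm).pow_const 2

theorem integral_multiplierSpectralMeasure (x : H) {f : ℝ → ℂ} (hf : Measurable f) :
    ∫ l, f l ∂((multiplierSpectralMeasure U hm).measure x) =
      ∫ a, ((‖U x a‖ ^ 2 : ℝ) : ℂ) * f (m a) ∂μ := by
  rw [multiplierSpectralMeasure_measure, integral_map hm.aemeasurable hf.aestronglyMeasurable,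
    integral_withDensity_eq_integral_smul₀ (aemeasurable_nnnorm_sq _)]
  congr 1

theorem multiplierSpectralMeasure_isIntegral {f : ℝ → ℂ} (hf : Measurable f)
    (hfm : MemLp (fun a => f (m a)) ∞ μ) :
    (multiplierSpectralMeasure U hm).IsIntegral f (multiplierCLM U (fun a => f (m a)) hfm) := by
  intro x
  rw [integral_multiplierSpectralMeasure U hm x hf, inner_eq_integral U]
  apply integral_congr_ae
  filter_upwards [multiplierCLM_ae U hfm x] with a ha
  rw [ha, mul_assoc, Complex.mul_conj, Complex.normSq_eq_norm_sq]
  push_cast; ring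

/-- The maximal domain of multiplication by the real function `m`, transported by the
unitary `U`. -/
def multiplierDomain (m : α → ℝ) : Submodule ℂ H where
  carrier := {x | MemLp (fun a => (m a : ℂ) * U x a) 2 μ}
  add_mem' := by
    intro x y hx hy
    rw [Set.mem_ofPred_eq] at hx hy ⊢
    refine MemLp.ae_eq ?_ (hx.add hy)
    filter_upwards [Lp.coeFn_add (U x) (U y)] with a ha
    rw [map_add, ha, Pi.add_apply, Pi.add_apply]; ring
  zero_mem' := by
    rw [Set.mem_ofPred_eq]
    refine MemLp.ae_eq ?_ (MemLp.zero (ε := ℂ))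
    filter_upwards [Lp.coeFn_zero ℂ 2 μ] with a ha
    rw [map_zero, ha]; simp
  smul_mem' := by
    intro c x hx
    rw [Set.mem_ofPred_eq] at hx ⊢
    refine MemLp.ae_eq ?_ (hx.const_smul c)
    filter_upwards [Lp.coeFn_smul c (U x)] with a ha
    rw [map_smul, ha]; simp only [Pi.smul_apply, smul_eq_mul]; ring

theorem multiplierDomain_memLp {m : α → ℝ} (x : multiplierDomain U m) :
    MemLp (fun a => (m a : ℂ) * U x a) 2 μ := x.2

/-- Multiplication by the real function `m` with its maximal domain, transported by the
unitary `U`. -/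
def multiplier (m : α → ℝ) : H →ₗ.[ℂ] H where
  domain := multiplierDomain U m
  toFun :=
    { toFun := fun x => U.symm ((multiplierDomain_memLp U x).toLp)
      map_add' := fun x y => by
        rw [← map_add, ← MemLp.toLp_add]
        congr 1
        apply MemLp.toLp_congr
        filter_upwards [Lp.coeFn_add (U (x : H)) (U (y : H))] with a ha
        rw [Submodule.coe_add, map_add, ha, Pi.add_apply, Pi.add_apply]; ring
      map_smul' := fun c x => by
        rw [RingHom.id_apply, ← map_smul, ← MemLp.toLp_const_smul]
        congr 1
        apply MemLp.toLp_congr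
        filter_upwards [Lp.coeFn_smul c (U (x : H))] with a ha
        rw [Submodule.coe_smul, map_smul, ha]; simp only [Pi.smul_apply, smul_eq_mul]; ring }

theorem mem_multiplier_domain {m : α → ℝ} {x : H} :
    x ∈ (multiplier U m).domain ↔ MemLp (fun a => (m a : ℂ) * U x a) 2 μ := Iff.rfl

theorem multiplier_ae {m : α → ℝ} (x : (multiplier U m).domain) :
    U (multiplier U m x) =ᵐ[μ] fun a => (m a : ℂ) * U x a := by
  have : U (multiplier U m x) = MemLp.toLp _ x.2 := U.apply_symm_apply _
  rw [this]
  exact MemLp.coeFn_toLp _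

theorem mem_multiplier_graph {m : α → ℝ} {x y : H} :
    (x, y) ∈ (multiplier U m).graph ↔ U y =ᵐ[μ] fun a => (m a : ℂ) * U x a := by
  rw [LinearPMap.mem_graph_iff]
  constructor
  · rintro ⟨z, rfl, rfl⟩
    exact multiplier_ae U z
  · intro h
    have hx : x ∈ (multiplier U m).domain :=
      (mem_multiplier_domain U).mpr ((Lp.memLp (U y)).ae_eq h)
    refine ⟨⟨x, hx⟩, rfl, U.injective (Lp.ext ?_)⟩
    exact (multiplier_ae U ⟨x, hx⟩).trans h.symm

include hm in
theorem aestronglyMeasurable_mul (x : Lp ℂ 2 μ) :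
    AEStronglyMeasurable (fun a => (m a : ℂ) * x a) μ :=
  (Complex.measurable_ofReal.comp hm).aestronglyMeasurable.mul (Lp.aestronglyMeasurable x)

theorem multiplierSpectralMeasure_isSpectralMeasureOf :
    (multiplierSpectralMeasure U hm).IsSpectralMeasureOf (multiplier U m) := by
  refine ⟨fun x => ?_, fun x => ?_⟩
  · rw [mem_multiplier_domain, memLp_two_iff_integrable_sq_norm (aestronglyMeasurable_mul hm _),
      multiplierSpectralMeasure_measure, integrable_map_measure (by fun_prop) hm.aemeasurable,
      integrable_withDensity_iff_integrable_smul₀ (aemeasurable_nnnorm_sq _)]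
    apply integrable_congr (.of_forall fun a => ?_)
    simp [NNReal.smul_def, mul_pow, mul_comm]
  · rw [integral_multiplierSpectralMeasure U hm x Complex.measurable_ofReal, inner_eq_integral U]
    apply integral_congr_ae
    filter_upwards [multiplier_ae U x] with a ha
    rw [ha, mul_assoc, Complex.mul_conj, Complex.normSq_eq_norm_sq]
    push_cast; ring

include hm in
theorem squareOp_multiplier : squareOp (multiplier U m) = multiplier U (fun a => m a ^ 2) := by
  have hdom : ∀ x : H, x ∈ (squareOp (multiplier U m)).domain ↔
      ∃ hx : x ∈ (multiplier U m).domain, multiplier U m ⟨x, hx⟩ ∈ (multiplier U m).domain := by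
    intro x
    constructor
    · rintro ⟨y, hy, rfl⟩
      exact ⟨y.2, hy⟩
    · rintro ⟨hx, hy⟩
      exact ⟨⟨x, hx⟩, hy, rfl⟩
  have hiff : ∀ (x : H) (hx : x ∈ (multiplier U m).domain),
      multiplier U m ⟨x, hx⟩ ∈ (multiplier U m).domain ↔
        x ∈ (multiplier U fun a => m a ^ 2).domain := by
    intro x hx
    rw [mem_multiplier_domain, mem_multiplier_domain]
    apply memLp_congr_ae
    filter_upwards [multiplier_ae U ⟨x, hx⟩] with a ha
    rw [ha]; push_cast; ring
  refine LinearPMap.ext (Submodule.ext fun x => ?_) fun x hx₁ hx₂ => ?_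
  · rw [hdom]
    refine ⟨fun ⟨hx, h⟩ => (hiff x hx).mp h, fun h => ?_⟩
    have hx : x ∈ (multiplier U m).domain := by
      rw [mem_multiplier_domain] at h ⊢
      -- The intermediate domain condition is automatic, since `|m| ≤ m² + 1`.
      refine MemLp.mono (h.norm.add (Lp.memLp (U x)).norm) (aestronglyMeasurable_mul hm _)
        (.of_forall fun a => ?_)
      simp only [Pi.add_apply, norm_mul, Complex.norm_real, Real.norm_eq_abs, Complex.ofReal_pow, norm_pow]
      rw [abs_of_nonneg (a := _ + _) (by positivity)]
      nlinarith [norm_nonneg (U x a), sq_nonneg (|m a| - 1), abs_nonneg (m a),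
        mul_nonneg (norm_nonneg (U x a)) (sq_nonneg (|m a| - 1)),
        mul_nonneg (norm_nonneg (U x a)) (abs_nonneg (m a))]
    exact ⟨hx, (hiff x hx).mpr h⟩
  · obtain ⟨hx, h⟩ := (hdom x).mp hx₁
    have e : squareOp (multiplier U m) ⟨x, hx₁⟩ = multiplier U m ⟨multiplier U m ⟨x, hx⟩, h⟩ := rfl
    rw [e]
    apply U.injective
    apply Lp.ext
    filter_upwards [multiplier_ae U ⟨multiplier U m ⟨x, hx⟩, h⟩, multiplier_ae U ⟨x, hx⟩,
      multiplier_ae U ⟨x, hx₂⟩] with a h1 h2 h3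
    rw [h1, h3, h2]; push_cast; ring

include hm in
theorem stronglyCommute_multiplier {m' : α → ℝ} (hm' : Measurable m') :
    StronglyCommute (multiplier U m) (multiplier U m') := by
  refine ⟨_, _, multiplierSpectralMeasure_isSpectralMeasureOf U hm,
    multiplierSpectralMeasure_isSpectralMeasureOf U hm', fun s t hs ht => ?_⟩
  ext x
  apply U.injective
  apply Lp.ext
  rw [mul_apply_eq_comp, mul_apply_eq_comp]
  filter_upwards [multiplierSpectralMeasure_proj_ae U hm hs x,
    multiplierSpectralMeasure_proj_ae U hm' ht x,
    multiplierSpectralMeasure_proj_ae U hm hs ((multiplierSpectralMeasure U hm').proj t x),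
    multiplierSpectralMeasure_proj_ae U hm' ht ((multiplierSpectralMeasure U hm).proj s x)]
    with a h1 h2 h3 h4
  rw [h3, h4, h1, h2]; ring

end Multiplication

/-! ### Uniqueness of the spectral measure of a multiplication operator -/

section Uniqueness

variable {H : Type*} [NormedAddCommGroup H] [InnerProductSpace ℂ H] [CompleteSpace H]

namespace SpectralMeasure

theorem proj_eq_self_of_compl_eq_zero (E : SpectralMeasure H) {s : Set ℝ} (hs : MeasurableSet s)
    {x : H} (h : E.proj sᶜ x = 0) : E.proj s x = x := by
  have := E.proj_add_proj_compl hs x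
  rwa [h, add_zero] at this

/-- One-sided inclusion of ranges on closed intervals already forces equality. Taking adjoints,
`E(I) F(J) = 0` whenever the interval `I` is disjoint from `J`. Each point outside an interval `J`
has a neighbourhood `I` of this kind, so the `E`-measure of `F(J) x` lives on `J`, which is the
reverse inclusion. Finite measures agreeing on closed intervals are equal. -/
theorem measure_eq_of_proj_Icc {E F : SpectralMeasure H}
    (h : ∀ (c r : ℝ), 0 ≤ r → ∀ x, E.proj (Set.Icc (c - r) (c + r)) x = x →
      F.proj (Set.Icc (c - r) (c + r)) x = x) (x : H) :
    E.measure x = F.measure x := by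
  have hFE : ∀ (c r : ℝ), 0 ≤ r → ∀ x, F.proj (Set.Icc (c - r) (c + r))
      (E.proj (Set.Icc (c - r) (c + r)) x) = E.proj (Set.Icc (c - r) (c + r)) x := by
    intro c r hr x
    refine h c r hr _ ?_
    rw [E.proj_proj measurableSet_Icc measurableSet_Icc, Set.inter_self]
  have hdisj : ∀ (c r : ℝ) (J : Set ℝ), 0 ≤ r → MeasurableSet J →
      Disjoint J (Set.Icc (c - r) (c + r)) → ∀ x,
      E.proj (Set.Icc (c - r) (c + r)) (F.proj J x) = 0 := by
    intro c r J hr hJ hd x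
    refine ext_inner_right ℂ fun y => ?_
    rw [E.proj_inner_left measurableSet_Icc, F.proj_inner_left hJ, ← hFE c r hr,
      F.proj_proj hJ measurableSet_Icc, hd.inter_eq, F.proj_empty]
    simp
  have hEF : ∀ (c r : ℝ) (x : H), E.proj (Set.Icc (c - r) (c + r))
      (F.proj (Set.Icc (c - r) (c + r)) x) = F.proj (Set.Icc (c - r) (c + r)) x := by
    intro c r x
    apply E.proj_eq_self_of_compl_eq_zero measurableSet_Icc
    rw [← E.measure_eq_zero_iff _ measurableSet_Icc.compl]
    apply measure_null_of_locally_null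
    intro l hl
    obtain ⟨ε, hε, hs⟩ := Metric.nhds_basis_closedBall.mem_iff.mp
      (isClosed_Icc.isOpen_compl.mem_nhds hl)
    refine ⟨_, mem_nhdsWithin_of_mem_nhds (Metric.closedBall_mem_nhds l hε), ?_⟩
    rw [Real.closedBall_eq_Icc] at hs ⊢
    rw [E.measure_eq_zero_iff _ measurableSet_Icc]
    exact hdisj l ε _ hε.le measurableSet_Icc (Set.disjoint_left.mpr fun a ha hb => hs hb ha) x
  have heq : ∀ (c r : ℝ), 0 ≤ r → ∀ x, E.proj (Set.Icc (c - r) (c + r)) x =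
      F.proj (Set.Icc (c - r) (c + r)) x := by
    intro c r hr x
    rw [← hEF]
    refine ext_inner_right ℂ fun y => ?_
    rw [E.proj_inner_left measurableSet_Icc, E.proj_inner_left measurableSet_Icc,
      F.proj_inner_left measurableSet_Icc, hFE c r hr]
  refine Measure.ext_of_Icc _ _ fun {a b} hab => ?_
  have e : Set.Icc a b = Set.Icc ((a + b) / 2 - (b - a) / 2) ((a + b) / 2 + (b - a) / 2) := by
    congr 1 <;> ring
  rw [e, E.measure_apply' _ measurableSet_Icc, F.measure_apply' _ measurableSet_Icc,
    heq _ _ (by linarith)]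

end SpectralMeasure

variable {α : Type*} [MeasurableSpace α] {μ : Measure α} (U : H ≃ₗᵢ[ℂ] Lp ℂ 2 μ)
  {m : α → ℝ} (hm : Measurable m)

/-- Where `|m - c| ≥ ρ`, multiplication by `m - c` expands pointwise by at least `ρ`. -/
theorem norm_proj_outside_le {c ρ : ℝ} (hρ : 0 < ρ) (x : (multiplier U m).domain) :
    ρ * ‖(multiplierSpectralMeasure U hm).proj {l | ρ ≤ |l - c|} x‖ ≤
      ‖(multiplierSpectralMeasure U hm).proj {l | ρ ≤ |l - c|}
        (multiplier U m x - (c : ℂ) • (x : H))‖ := by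
  have hs : MeasurableSet {l : ℝ | ρ ≤ |l - c|} := measurableSet_le (by fun_prop) (by fun_prop)
  rw [← U.norm_map, ← U.norm_map ((multiplierSpectralMeasure U hm).proj _ (_ - _)),
    ← le_inv_mul_iff₀ hρ]
  refine Lp.norm_le_mul_norm_of_ae_le_mul ?_
  filter_upwards [multiplierSpectralMeasure_proj_ae U hm hs x,
    multiplierSpectralMeasure_proj_ae U hm hs (multiplier U m x - (c : ℂ) • (x : H)),
    multiplier_ae U x, Lp.coeFn_smul (c : ℂ) (U (x : H)),
    Lp.coeFn_sub (U (multiplier U m x)) ((c : ℂ) • U (x : H))] with a h1 h2 h3 h4 h5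
  rw [h1, h2, map_sub, map_smul, h5, Pi.sub_apply, h3, h4]
  by_cases h : a ∈ m ⁻¹' {l | ρ ≤ |l - c|}
  · have h' : ρ ≤ |m a - c| := h
    have e : (m a : ℂ) * U x a - (c : ℂ) * U x a = ((m a - c : ℝ) : ℂ) * U x a := by
      push_cast; ring
    rw [Set.indicator_of_mem h, Pi.one_apply, one_mul, one_mul, Pi.smul_apply, smul_eq_mul, e,
      norm_mul, Complex.norm_real, Real.norm_eq_abs, le_inv_mul_iff₀ hρ]
    gcongr
  · rw [Set.indicator_of_notMem h]; simp

/-- A growth comparison. On the range of `E [c - r, c + r]` the operator `T - c` iterates with `‖(T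
- c)^n x‖ ≤ r^n ‖x‖`, while the part of `x` that `F` places at distance at least `r + ε` from `c` is
expanded by `r + ε` each time. That part is at most `(r / (r + ε))^n ‖x‖` for every `n`, hence zero.
-/
theorem multiplierSpectralMeasure_proj_eq_self {E : SpectralMeasure H}
    (hE : E.IsSpectralMeasureOf (multiplier U m)) {c r : ℝ} (hr : 0 ≤ r) {x : H}
    (hx : E.proj (Set.Icc (c - r) (c + r)) x = x) :
    (multiplierSpectralMeasure U hm).proj (Set.Icc (c - r) (c + r)) x = x := by
  set F := multiplierSpectralMeasure U hm with hF
  have key : ∀ ε : ℝ, 0 < ε → F.proj {l | r + ε ≤ |l - c|} x = 0 := by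
    intro ε hε
    have hρ : 0 < r + ε := by linarith
    have hs : MeasurableSet {l : ℝ | r + ε ≤ |l - c|} :=
      measurableSet_le (by fun_prop) (by fun_prop)
    have hpow : ∀ n : ℕ, ∀ y : H, E.proj (Set.Icc (c - r) (c + r)) y = y →
        ‖F.proj {l | r + ε ≤ |l - c|} y‖ ≤ (r / (r + ε)) ^ n * ‖y‖ := by
      intro n
      induction n with
      | zero =>
        intro y _
        rw [pow_zero, one_mul]
        exact ((F.proj _).le_of_opNorm_le (F.isStarProjection _ hs).norm_le y).trans_eq (one_mul _)
      | succ n ih =>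
        intro y hy
        have hyd : y ∈ (multiplier U m).domain := hy ▸ hE.mem_domain_proj_Icc _ _ _
        have h1 := norm_proj_outside_le U hm (c := c) hρ ⟨y, hyd⟩
        have h2 := hE.norm_sub_le ⟨y, hyd⟩ hy
        have h3 := ih (multiplier U m ⟨y, hyd⟩ - (c : ℂ) • y) (by
          rw [map_sub, map_smul, hy, hE.proj_apply measurableSet_Icc ⟨y, hyd⟩ hy])
        have h4 : (r + ε) * ‖F.proj {l | r + ε ≤ |l - c|} y‖ ≤
            (r / (r + ε)) ^ n * (r * ‖y‖) := by
          refine h1.trans (h3.trans ?_)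
          gcongr
        rw [← le_inv_mul_iff₀ hρ] at h4
        refine h4.trans_eq ?_
        rw [pow_succ]; field_simp
    have hlim : Tendsto (fun n : ℕ => (r / (r + ε)) ^ n * ‖x‖) atTop (𝓝 (0 * ‖x‖)) :=
      (tendsto_pow_atTop_nhds_zero_of_lt_one (by positivity)
        ((div_lt_one hρ).mpr (by linarith))).mul_const _
    rw [zero_mul] at hlim
    have := ge_of_tendsto' hlim fun n => hpow n x hx
    simpa using this
  apply F.proj_eq_self_of_compl_eq_zero measurableSet_Icc
  rw [← F.measure_eq_zero_iff _ measurableSet_Icc.compl]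
  -- The growth argument needs a gap `ε > 0`, so the complement is exhausted by the gaps `1 / (k +
  -- 1)`.
  have hsub : (Set.Icc (c - r) (c + r))ᶜ ⊆ ⋃ k : ℕ, {l | r + 1 / ((k : ℝ) + 1) ≤ |l - c|} := by
    intro l hl
    have hl' : r < |l - c| := by
      by_contra hcon
      have := abs_le.mp (not_lt.mp hcon)
      exact hl ⟨by linarith [this.1], by linarith [this.2]⟩
    obtain ⟨k, hk⟩ := exists_nat_one_div_lt (sub_pos.mpr hl')
    exact Set.mem_iUnion.mpr ⟨k, by simp only [Set.mem_ofPred_eq]; linarith⟩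
  refine measure_mono_null hsub (measure_iUnion_null fun k => ?_)
  rw [F.measure_eq_zero_iff _ (measurableSet_le (by fun_prop) (by fun_prop))]
  exact key _ (by positivity)

include hm in
-- The chosen operator comes from an unspecified spectral measure `E`. Uniqueness gives `E` the same
-- scalar measures as the explicit one, and over `ℂ` the quadratic form determines a bounded
-- operator.
theorem boundedFunction_multiplier {f : ℝ → ℂ} (hf : Measurable f)
    (hfm : MemLp (fun a => f (m a)) ∞ μ) :
    boundedFunction (multiplier U m) f = multiplierCLM U (fun a => f (m a)) hfm := by
  have h : ∃ S : H →L[ℂ] H, ∃ E : SpectralMeasure H,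
      E.IsSpectralMeasureOf (multiplier U m) ∧ E.IsIntegral f S :=
    ⟨_, _, multiplierSpectralMeasure_isSpectralMeasureOf U hm,
      multiplierSpectralMeasure_isIntegral U hm hf hfm⟩
  rw [boundedFunction, dif_pos h]
  obtain ⟨E, hE, hS⟩ := h.choose_spec
  have hμ : ∀ x, E.measure x = (multiplierSpectralMeasure U hm).measure x :=
    SpectralMeasure.measure_eq_of_proj_Icc fun c r hr x hx =>
      multiplierSpectralMeasure_proj_eq_self U hm hE hr hx
  have hq : ∀ x : H, ⟪x, h.choose x⟫_ℂ = ⟪x, multiplierCLM U (fun a => f (m a)) hfm x⟫_ℂ := by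
    intro x
    rw [hS x, hμ x, multiplierSpectralMeasure_isIntegral U hm hf hfm x]
  refine ContinuousLinearMap.coe_injective ((ext_inner_map _ _).mp fun x => ?_)
  rw [← inner_conj_symm, ← inner_conj_symm (_ : H) x]
  exact congrArg _ (hq x)

end Uniqueness

/-! ### Graphs of multiplication operators -/

section ClosedMultiplier

variable {H : Type*} [NormedAddCommGroup H] [InnerProductSpace ℂ H] [CompleteSpace H]
  {α : Type*} [MeasurableSpace α] {μ : Measure α} (U : H ≃ₗᵢ[ℂ] Lp ℂ 2 μ)
  {m : α → ℝ} (hm : Measurable m)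

include hm in
-- The relation `U y = m U x` can be tested on the sets `|m| ≤ n`, which exhaust `α`. On each of
-- them it is an equality of bounded operators, a closed condition.
theorem isClosed_multiplier : (multiplier U m).IsClosed := by
  have hs : ∀ n : ℕ, MeasurableSet {a | |m a| ≤ n} := fun n =>
    measurableSet_le (by fun_prop) (by fun_prop)
  have hmem : ∀ n : ℕ, MemLp ({a | |m a| ≤ n}.indicator fun a => (m a : ℂ)) ∞ μ := fun n =>
    memLp_top_of_bound
      ((Complex.measurable_ofReal.comp hm).indicator (hs n)).aestronglyMeasurable n
      (.of_forall fun a => by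
        by_cases h : a ∈ {a | |m a| ≤ n}
        · rw [Set.indicator_of_mem h, Complex.norm_real]; exact h
        · rw [Set.indicator_of_notMem h, norm_zero]; positivity)
  have hgraph : ((multiplier U m).graph : Set (H × H)) = ⋂ n : ℕ,
      {z | multiplierCLM U ({a | |m a| ≤ n}.indicator 1) (memLp_indicator_one (hs n)) z.2 =
        multiplierCLM U _ (hmem n) z.1} := by
    ext ⟨x, y⟩
    rw [SetLike.mem_coe, mem_multiplier_graph, Set.mem_iInter]
    constructor
    · intro h n
      apply U.injective
      apply Lp.ext
      filter_upwards [h, multiplierCLM_ae U (memLp_indicator_one (hs n)) y,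
        multiplierCLM_ae U (hmem n) x] with a h1 h2 h3
      rw [h2, h3, h1]
      by_cases h : a ∈ {a | |m a| ≤ n}
      · rw [Set.indicator_of_mem h, Set.indicator_of_mem h]; simp
      · rw [Set.indicator_of_notMem h, Set.indicator_of_notMem h]; simp
    · intro h
      have h2 : ∀ᵐ a ∂μ, ∀ n : ℕ, U (multiplierCLM U _ (memLp_indicator_one (hs n)) y) a =
          {a | |m a| ≤ n}.indicator 1 a * U y a :=
        ae_all_iff.mpr fun n => multiplierCLM_ae U (memLp_indicator_one (hs n)) y
      have h3 : ∀ᵐ a ∂μ, ∀ n : ℕ, U (multiplierCLM U _ (hmem n) x) a =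
          {a | |m a| ≤ n}.indicator (fun a => (m a : ℂ)) a * U x a :=
        ae_all_iff.mpr fun n => multiplierCLM_ae U (hmem n) x
      filter_upwards [h2, h3] with a h2 h3
      obtain ⟨n, hn⟩ := exists_nat_ge |m a|
      have hn' : a ∈ {a | |m a| ≤ n} := hn
      have h1 : multiplierCLM U ({a | |m a| ≤ n}.indicator 1) (memLp_indicator_one (hs n)) y =
        multiplierCLM U _ (hmem n) x := h n
      have e2 := h2 n
      have e3 := h3 n
      rw [Set.indicator_of_mem hn'] at e2 e3
      rw [h1, e3] at e2
      simpa using e2.symm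
  rw [LinearPMap.IsClosed, hgraph]
  exact isClosed_iInter fun n => isClosed_eq (by fun_prop) (by fun_prop)

theorem norm_inv_add_I_le (r : ℝ) : ‖((r : ℂ) + Complex.I)⁻¹‖ ≤ 1 := by
  rw [norm_inv]
  refine inv_le_one_of_one_le₀ ?_
  have := Complex.abs_im_le_norm ((r : ℂ) + Complex.I)
  simpa using this

theorem ofReal_add_I_ne_zero (r : ℝ) : (r : ℂ) + Complex.I ≠ 0 := fun h => by
  simpa using congrArg Complex.im h

include hm in
theorem memLp_inv_add_I : MemLp (fun a => ((m a : ℂ) + Complex.I)⁻¹) ∞ μ :=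
  memLp_top_of_bound
    (((Complex.measurable_ofReal.comp hm).add_const _).inv).aestronglyMeasurable 1
    (.of_forall fun _ => norm_inv_add_I_le _)

/-- A closed set which contains the points of the graph of a multiplication operator given by the
resolvent on a dense set contains the whole graph. -/
theorem multiplier_graph_subset {S : Set (H × H)} (hS : IsClosed S) {ι : Type*} {v : ι → H}
    (hv : DenseRange v)
    (h : ∀ i, (multiplierCLM U _ (memLp_inv_add_I hm) (v i),
      v i - Complex.I • multiplierCLM U _ (memLp_inv_add_I hm) (v i)) ∈ S) :
    ((multiplier U m).graph : Set (H × H)) ⊆ S := by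
  rintro ⟨x, y⟩ hxy
  rw [SetLike.mem_coe, mem_multiplier_graph] at hxy
  set R := multiplierCLM U _ (memLp_inv_add_I hm) with hR
  have hall : ∀ z, (R z, z - Complex.I • R z) ∈ S := fun z =>
    hv.induction_on (p := fun z => (R z, z - Complex.I • R z) ∈ S) z
      (hS.preimage (by fun_prop)) h
  -- With `R` the multiplication by `1 / (m + i)`, a graph point `(x, y)` is `(R z, z - i R z)` for
  -- `z = y + i x`, so `hall` covers the whole graph.
  have hx : R (y + Complex.I • x) = x := by
    apply U.injective
    apply Lp.ext
    filter_upwards [multiplierCLM_ae U (memLp_inv_add_I hm) (y + Complex.I • x), hxy,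
      Lp.coeFn_add (U y) (Complex.I • U x), Lp.coeFn_smul Complex.I (U x)] with a h1 h2 h3 h4
    rw [hR, h1, map_add, map_smul, h3, Pi.add_apply, h4, h2, Pi.smul_apply, smul_eq_mul]
    have := ofReal_add_I_ne_zero (m a)
    field_simp
  have := hall (y + Complex.I • x)
  rw [hx] at this
  simpa using this

end ClosedMultiplier

/-! ### Test functions as a core, and the Fourier symbols of the two operators -/

section TestFunctions

open SchwartzMap FourierTransform

theorem testToL2_ae (f : testSpace) : testToL2 f =ᵐ[volume] (f : ℝ → ℂ) :=
  (testSpace_memLp f).coeFn_toLp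

theorem denseRange_testToL2 : DenseRange testToL2 := by
  intro f
  refine (mem_closure_iff_nhds_basis Metric.nhds_basis_closedBall).2 fun ε hε ↦ ?_
  obtain ⟨g, hg₁, hg₂, hg₃⟩ := MemLp.exist_eLpNorm_sub_le ENNReal.ofNat_ne_top
    (Fact.out : (1 : ℝ≥0∞) ≤ 2) (Lp.memLp f) hε
  refine ⟨_, ⟨⟨g, hg₂, hg₁⟩, rfl⟩, ?_⟩
  have : (f : ℝ → ℂ) - (testToL2 ⟨g, hg₂, hg₁⟩ : ℝ → ℂ) =ᵐ[volume] (f : ℝ → ℂ) - g := by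
    filter_upwards [testToL2_ae ⟨g, hg₂, hg₁⟩] with a ha
    rw [Pi.sub_apply, ha]; rfl
  rw [Metric.mem_closedBall', Lp.dist_def, eLpNorm_congr_ae this]
  exact ENNReal.toReal_le_of_le_ofReal hε.le hg₃

theorem mem_testOperator_graph (L : testSpace →ₗ[ℂ] testSpace) {z : L2R × L2R} :
    z ∈ (testOperator L).graph ↔ ∃ f, (testToL2 f, testToL2 (L f)) = z := by
  rw [LinearPMap.mem_graph_iff]
  have key : ∀ f, testOperator L ⟨testToL2 f, f, rfl⟩ = testToL2 (L f) := fun f => by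
    change testToL2 (L ((LinearEquiv.ofInjective testToL2 testToL2_injective).symm _)) = _
    congr 2
    exact (LinearEquiv.ofInjective testToL2 testToL2_injective).symm_apply_apply f
  constructor
  · rintro ⟨⟨_, f, rfl⟩, h1, h2⟩
    exact ⟨f, Prod.ext h1 ((key f).symm.trans h2)⟩
  · rintro ⟨f, rfl⟩
    exact ⟨⟨testToL2 f, f, rfl⟩, rfl, key f⟩

/-- A test function as a Schwartz function. -/
def testToSchwartz (f : testSpace) : 𝓢(ℝ, ℂ) := f.2.2.toSchwartzMap f.2.1

theorem testToSchwartz_toLp (f : testSpace) : (testToSchwartz f).toLp 2 volume = testToL2 f := rfl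

/-- The cutoff `x ↦ χ (x / (n + 1)) f x` of a Schwartz function. -/
def cutoff (χ : testSpace) (n : ℕ) (f : 𝓢(ℝ, ℂ)) : testSpace :=
  ⟨fun x => (χ : ℝ → ℂ) (((n : ℝ) + 1)⁻¹ * x) * f x,
    (χ.2.1.comp (contDiff_const.mul contDiff_id)).mul f.smooth',
    HasCompactSupport.mul_right (χ.2.2.comp_homeomorph
      (Homeomorph.mulLeft₀ ((n : ℝ) + 1)⁻¹ (by positivity)))⟩

theorem testDeriv_cutoff (χ : testSpace) (n : ℕ) (f : 𝓢(ℝ, ℂ)) :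
    testDeriv (cutoff χ n f) = (((n : ℝ) + 1)⁻¹ : ℂ) • cutoff (testDeriv χ) n f +
      cutoff χ n (derivCLM ℂ ℂ f) := by
  ext x
  change deriv (fun x => (χ : ℝ → ℂ) (((n : ℝ) + 1)⁻¹ * x) * f x) x =
    (((n : ℝ) + 1)⁻¹ : ℂ) * (deriv (χ : ℝ → ℂ) (((n : ℝ) + 1)⁻¹ * x) * f x) +
      (χ : ℝ → ℂ) (((n : ℝ) + 1)⁻¹ * x) * deriv f x
  have h1 : HasDerivAt (χ : ℝ → ℂ) (deriv (χ : ℝ → ℂ) (((n : ℝ) + 1)⁻¹ * x))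
      (((n : ℝ) + 1)⁻¹ * x) := (((contDiff_infty_iff_deriv.mp χ.2.1).1) _).hasDerivAt
  have h2 : HasDerivAt (fun x : ℝ => ((n : ℝ) + 1)⁻¹ * x) (((n : ℝ) + 1)⁻¹ * 1) x :=
    (hasDerivAt_id x).const_mul _
  have h3 := h1.scomp x h2
  have h4 := (h3.mul (f.hasDerivAt x)).deriv
  simp only [Function.comp_def, Complex.real_smul] at h4
  refine Eq.trans h4 ?_
  push_cast; ring

/-- The value `χ 0` is left arbitrary because the lemma is also applied to `χ'` and `χ''`. Their
terms carry factors `1 / (n + 1)`, so only convergence to some limit matters for them. -/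
theorem tendsto_cutoff (χ : testSpace) (f : 𝓢(ℝ, ℂ)) :
    Tendsto (fun n => testToL2 (cutoff χ n f)) atTop (𝓝 ((χ : ℝ → ℂ) 0 • f.toLp 2 volume)) := by
  obtain ⟨C, hC⟩ := χ.2.1.continuous.bounded_above_of_compact_support χ.2.2
  refine tendsto_L2_of_bounded_multiplier (l := atTop) (f.toLp 2 volume)
    (fun (n : ℕ) x => (χ : ℝ → ℂ) (((n : ℝ) + 1)⁻¹ * x)) (fun _ => (χ : ℝ → ℂ) 0) C (fun n x => hC _)
    (fun x => ?_) (fun _ => hC 0) (fun n => testToL2 (cutoff χ n f))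
    ((χ : ℝ → ℂ) 0 • f.toLp 2 volume) (fun n => ?_) ?_
  · refine (χ.2.1.continuous.tendsto 0).comp ?_
    have := (tendsto_one_div_add_atTop_nhds_zero_nat (𝕜 := ℝ)).mul_const x
    simpa using this
  · filter_upwards [testToL2_ae (cutoff χ n f), f.coeFn_toLp 2 volume] with x h1 h2
    rw [h1, h2]; rfl
  · exact Lp.coeFn_smul _ _

theorem exists_testSpace_eq_one : ∃ χ : testSpace, (χ : ℝ → ℂ) 0 = 1 := by
  let b : ContDiffBump (0 : ℝ) := default
  refine ⟨⟨fun x => (b x : ℂ), Complex.ofRealCLM.contDiff.comp b.contDiff,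
    b.hasCompactSupport.comp_left (g := Complex.ofReal) rfl⟩, ?_⟩
  change ((b 0 : ℝ) : ℂ) = 1
  rw [b.one_of_mem_closedBall (Metric.mem_closedBall_self b.rIn_pos.le), Complex.ofReal_one]

/-- Each derivative falling on the cutoff `χ (x / (n + 1))` costs a factor `1 / (n + 1)`. In the
limit only the term with all derivatives on `f` survives. -/
theorem exists_testSpace_tendsto (f : 𝓢(ℝ, ℂ)) : ∃ φ : ℕ → testSpace,
    Tendsto (fun n => testToL2 (φ n)) atTop (𝓝 (f.toLp 2 volume)) ∧
    Tendsto (fun n => testToL2 (testDeriv (φ n))) atTop (𝓝 ((derivCLM ℂ ℂ f).toLp 2 volume)) ∧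
    Tendsto (fun n => testToL2 (testDeriv (testDeriv (φ n)))) atTop
      (𝓝 ((derivCLM ℂ ℂ (derivCLM ℂ ℂ f)).toLp 2 volume)) := by
  obtain ⟨χ, hχ⟩ := exists_testSpace_eq_one
  have hn : Tendsto (fun n : ℕ => (((n : ℝ) + 1)⁻¹ : ℂ)) atTop (𝓝 0) := by
    have := (Complex.continuous_ofReal.tendsto 0).comp
      (tendsto_one_div_add_atTop_nhds_zero_nat (𝕜 := ℝ))
    simpa [Function.comp_def] using this
  refine ⟨fun n => cutoff χ n f, ?_, ?_, ?_⟩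
  · simpa [hχ] using tendsto_cutoff χ f
  · simp_rw [testDeriv_cutoff, map_add, map_smul]
    simpa [hχ] using (hn.smul (tendsto_cutoff (testDeriv χ) f)).add
      (tendsto_cutoff χ (derivCLM ℂ ℂ f))
  · simp_rw [testDeriv_cutoff, map_add, map_smul, testDeriv_cutoff, map_add, map_smul]
    simpa [hχ] using (hn.smul ((hn.smul (tendsto_cutoff (testDeriv (testDeriv χ)) f)).add
      (tendsto_cutoff (testDeriv χ) (derivCLM ℂ ℂ f)))).add
      ((hn.smul (tendsto_cutoff (testDeriv χ) (derivCLM ℂ ℂ f))).add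
      (tendsto_cutoff χ (derivCLM ℂ ℂ (derivCLM ℂ ℂ f))))

/-- The Fourier transform as a unitary map of `L²(ℝ; ℂ)`. -/
abbrev fourierL2 : L2R ≃ₗᵢ[ℂ] L2R := Lp.fourierTransformₗᵢ ℝ ℂ

theorem fourierL2_toLp (f : 𝓢(ℝ, ℂ)) : fourierL2 (f.toLp 2 volume) = (𝓕 f).toLp 2 volume :=
  SchwartzMap.toLp_fourier_eq f

/-- If the operator `Λ` on Schwartz functions extends `L` and is multiplication by the smooth real
function `m` on the Fourier side, then the closure of `L` is the maximal multiplication operator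
by `m` on the Fourier side. -/
theorem closure_testOperator_eq_multiplier {L : testSpace →ₗ[ℂ] testSpace}
    {Λ : 𝓢(ℝ, ℂ) → 𝓢(ℝ, ℂ)} {m : ℝ → ℝ} (hm : ContDiff ℝ ∞ m)
    (hLΛ : ∀ f, testToL2 (L f) = (Λ (testToSchwartz f)).toLp 2 volume)
    (hΛm : ∀ f w, 𝓕 (Λ f) w = (m w : ℂ) * 𝓕 f w)
    (hΛ : ∀ f : 𝓢(ℝ, ℂ), (f.toLp 2 volume, (Λ f).toLp 2 volume) ∈
      closure ((testOperator L).graph : Set (L2R × L2R))) :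
    (testOperator L).closure = multiplier fourierL2 m := by
  have hmm : Measurable m := hm.continuous.measurable
  -- This inclusion also gives closability, which the closure needs in order not to be a default
  -- value.
  have hle : testOperator L ≤ multiplier fourierL2 m := by
    apply LinearPMap.le_of_le_graph
    intro z hz
    obtain ⟨f, rfl⟩ := (mem_testOperator_graph L).mp hz
    rw [mem_multiplier_graph, hLΛ, ← testToSchwartz_toLp, fourierL2_toLp, fourierL2_toLp]
    filter_upwards [(𝓕 (Λ (testToSchwartz f))).coeFn_toLp 2 volume,
      (𝓕 (testToSchwartz f)).coeFn_toLp 2 volume] with w h1 h2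
    rw [h1, h2, hΛm]
  have hcl := isClosed_multiplier fourierL2 hmm
  have hclosable : (testOperator L).IsClosable := hcl.isClosable.leIsClosable hle
  apply LinearPMap.eq_of_eq_graph
  rw [← hclosable.graph_closure_eq_closure_graph]
  apply le_antisymm
  · exact Submodule.topologicalClosure_minimal _ (LinearPMap.le_graph_of_le hle) hcl
  · rw [← SetLike.coe_subset_coe, Submodule.topologicalClosure_coe]
    refine multiplier_graph_subset fourierL2 hmm isClosed_closure
      (v := fun h : testSpace => fourierL2.symm (testToL2 h))
      (fourierL2.symm.surjective.denseRange.comp denseRange_testToL2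
        fourierL2.symm.continuous) fun h => ?_
    -- Smoothness of `m` and `m + i ≠ 0` make `h / (m + i)` a test function. Its inverse Fourier
    -- transform is therefore Schwartz, and it is the resolvent applied to the dense vector indexed
    -- by `h`; this gives the graph points needed for `multiplier_graph_subset`.
    let u : testSpace := ⟨fun w => ((m w : ℂ) + Complex.I)⁻¹ * (h : ℝ → ℂ) w,
      (ContDiff.inv ((Complex.ofRealCLM.contDiff.comp hm).add contDiff_const)
        fun w => ofReal_add_I_ne_zero _).mul h.2.1, h.2.2.mul_left⟩
    have hu : 𝓕 (𝓕⁻ (testToSchwartz u)) = testToSchwartz u := by simp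
    have h1 : (𝓕⁻ (testToSchwartz u)).toLp 2 volume =
        multiplierCLM fourierL2 _ (memLp_inv_add_I hmm) (fourierL2.symm (testToL2 h)) := by
      apply fourierL2.injective
      apply Lp.ext
      rw [fourierL2_toLp, hu]
      filter_upwards [multiplierCLM_ae fourierL2 (memLp_inv_add_I hmm)
        (fourierL2.symm (testToL2 h)), testToL2_ae h,
        (testToSchwartz u).coeFn_toLp 2 volume] with w e1 e2 e3
      rw [e1, e3, LinearIsometryEquiv.apply_symm_apply, e2]
      rfl
    have h2 : (Λ (𝓕⁻ (testToSchwartz u))).toLp 2 volume = fourierL2.symm (testToL2 h) -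
        Complex.I • (𝓕⁻ (testToSchwartz u)).toLp 2 volume := by
      apply fourierL2.injective
      apply Lp.ext
      rw [fourierL2_toLp, map_sub, map_smul, fourierL2_toLp, hu,
        LinearIsometryEquiv.apply_symm_apply]
      filter_upwards [testToL2_ae h, (testToSchwartz u).coeFn_toLp 2 volume,
        (𝓕 (Λ (𝓕⁻ (testToSchwartz u)))).coeFn_toLp 2 volume,
        Lp.coeFn_sub (testToL2 h) (Complex.I • (testToSchwartz u).toLp 2 volume),
        Lp.coeFn_smul Complex.I ((testToSchwartz u).toLp 2 volume)] with w e1 e2 e3 e4 e5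
      rw [e3, e4, Pi.sub_apply, e5, Pi.smul_apply, e1, e2, hΛm, hu]
      change (m w : ℂ) * (((m w : ℂ) + Complex.I)⁻¹ * (h : ℝ → ℂ) w) =
        (h : ℝ → ℂ) w - Complex.I * (((m w : ℂ) + Complex.I)⁻¹ * (h : ℝ → ℂ) w)
      have := ofReal_add_I_ne_zero (m w)
      field_simp
      ring
    rw [← h1, ← h2]
    exact hΛ _

theorem fourier_derivCLM_apply (f : 𝓢(ℝ, ℂ)) (w : ℝ) :
    𝓕 (derivCLM ℂ ℂ f) w = 2 * Real.pi * Complex.I * w * 𝓕 f w := by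
  have h := congrFun (Real.fourier_deriv f.integrable (f.differentiable)
    (derivCLM ℂ ℂ f).integrable) w
  simp only [smul_eq_mul] at h
  exact h

/-- The symbol of the operator `(i / K) d/dξ`. -/
def momentumSymbol (K w : ℝ) : ℝ := -(2 * Real.pi / K) * w

theorem contDiff_momentumSymbol (K : ℝ) : ContDiff ℝ ∞ (momentumSymbol K) :=
  contDiff_const.mul contDiff_id

/-- The derivative has symbol `2πiw`, and `(i/K)(2πiw) = -2πw/K`. -/
theorem momentum_eq_multiplier (K : ℝ) :
    momentum K = multiplier fourierL2 (momentumSymbol K) := by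
  refine closure_testOperator_eq_multiplier
    (Λ := fun f => (Complex.I / (K : ℂ)) • derivCLM ℂ ℂ f) (contDiff_momentumSymbol K)
    (fun f => rfl) (fun f w => ?_) (fun f => ?_)
  · rw [FourierTransform.fourier_smul, _root_.smul_apply, fourier_derivCLM_apply,
      momentumSymbol, smul_eq_mul]
    push_cast
    linear_combination (2 * (Real.pi : ℂ) / K * w * 𝓕 f w) * Complex.I_mul_I
  · obtain ⟨φ, h0, h1, -⟩ := exists_testSpace_tendsto f
    refine mem_closure_of_tendsto (h0.prodMk_nhds (h1.const_smul (Complex.I / (K : ℂ))))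
      (.of_forall fun n => (mem_testOperator_graph _).mpr ⟨φ n, ?_⟩)
    simp

theorem waveOp_eq_multiplier (K : ℝ) :
    waveOp K = multiplier fourierL2 (fun w => momentumSymbol K w ^ 2) := by
  refine closure_testOperator_eq_multiplier
    (Λ := fun f => (-(1 / (K : ℂ) ^ 2)) • derivCLM ℂ ℂ (derivCLM ℂ ℂ f))
    ((contDiff_momentumSymbol K).pow 2)
    (fun f => rfl) (fun f w => ?_) (fun f => ?_)
  · rw [FourierTransform.fourier_smul, _root_.smul_apply, fourier_derivCLM_apply,
      fourier_derivCLM_apply, momentumSymbol, smul_eq_mul]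
    push_cast
    linear_combination (-(2 * (Real.pi : ℂ) / K * w) ^ 2 * 𝓕 f w) * Complex.I_mul_I
  · obtain ⟨φ, h0, -, h2⟩ := exists_testSpace_tendsto f
    refine mem_closure_of_tendsto (h0.prodMk_nhds (h2.const_smul (-(1 / (K : ℂ) ^ 2))))
      (.of_forall fun n => (mem_testOperator_graph _).mpr ⟨φ n, ?_⟩)
    simp

end TestFunctions

/-! ### Translations as Fourier multipliers -/

section Translation

open SchwartzMap FourierTransform

/-- The translation `g ↦ g (· + a)` of `L²(ℝ; ℂ)`. -/
def translation (a : ℝ) : L2R →L[ℂ] L2R :=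
  (Lp.compMeasurePreservingₗᵢ ℂ (fun x => x + a)
    (measurePreserving_add_right volume a)).toContinuousLinearMap

theorem translation_ae (a : ℝ) (g : L2R) : translation a g =ᵐ[volume] fun x => g (x + a) :=
  Lp.coeFn_compMeasurePreserving g (measurePreserving_add_right volume a)

/-- The character `w ↦ exp (2 π i a w)`. -/
def character (a w : ℝ) : ℂ := Complex.exp ((2 * Real.pi * (a * w) : ℝ) * Complex.I)

theorem norm_character (a w : ℝ) : ‖character a w‖ = 1 := Complex.norm_exp_ofReal_mul_I _

theorem continuous_character : Continuous (fun z : ℝ × ℝ => character z.1 z.2) := by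
  unfold character; fun_prop

theorem memLp_character (a : ℝ) : MemLp (character a) ∞ (volume : Measure ℝ) :=
  memLp_top_of_bound
    (continuous_character.comp (Continuous.prodMk_right a)).aestronglyMeasurable 1
    (.of_forall fun w => (norm_character a w).le)

theorem fourier_comp_add_right (f : ℝ → ℂ) (a w : ℝ) :
    𝓕 (fun x => f (x + a)) w = character a w * 𝓕 f w := by
  rw [Real.fourier_eq', Real.fourier_eq', ← integral_const_mul]
  conv_rhs => rw [← integral_add_right_eq_self _ a]
  congr 1 with x
  simp only [smul_eq_mul, character]
  rw [← mul_assoc, ← Complex.exp_add]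
  congr 2
  simp only [RCLike.inner_apply, conj_trivial]
  push_cast; ring

/-- Both sides are bounded operators, so it suffices to compare them on the dense Schwartz
functions, where the identity is a change of variables in the Fourier integral. -/
theorem translation_eq_multiplierCLM (a : ℝ) :
    translation a = multiplierCLM fourierL2 (character a) (memLp_character a) := by
  ext1 g
  refine DenseRange.induction_on
    (p := fun g => translation a g = multiplierCLM fourierL2 (character a) (memLp_character a) g)
    (SchwartzMap.denseRange_toLpCLM (F := ℂ) (E := ℝ) (p := 2) (μ := volume) ENNReal.ofNat_ne_top)
    g (isClosed_eq (by fun_prop) (by fun_prop)) fun f => ?_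
  rw [SchwartzMap.toLpCLM_apply]
  have h1 : translation a (f.toLp 2 volume) = (f.compSubConstCLM ℂ (-a)).toLp 2 volume := by
    apply Lp.ext
    filter_upwards [translation_ae a (f.toLp 2 volume),
      (f.compSubConstCLM ℂ (-a)).coeFn_toLp 2 volume,
      (measurePreserving_add_right volume a).quasiMeasurePreserving.ae
        (f.coeFn_toLp 2 volume)] with x e1 e2 e3
    rw [e1, e2, e3, compSubConstCLM_apply, sub_neg_eq_add]
  rw [h1]
  apply fourierL2.injective
  apply Lp.ext
  rw [fourierL2_toLp]
  filter_upwards [multiplierCLM_ae fourierL2 (memLp_character a) (f.toLp 2 volume),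
    (𝓕 (f.compSubConstCLM ℂ (-a))).coeFn_toLp 2 volume,
    (𝓕 f).coeFn_toLp 2 volume] with w e1 e2 e3
  have e4 : ⇑(f.compSubConstCLM ℂ (-a)) = fun x => f (x + a) := by
    ext x; simp
  rw [e1, e2, fourierL2_toLp, e3, SchwartzMap.fourier_coe, SchwartzMap.fourier_coe,
    ← fourier_comp_add_right, e4]

end Translation

/-! ### The cosine and sine functions of the momentum -/

section Functions

theorem memLp_cos_momentumSymbol (K τ : ℝ) :
    MemLp (fun w => ((Real.cos (τ * momentumSymbol K w) : ℝ) : ℂ)) ∞ (volume : Measure ℝ) :=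
  memLp_top_of_bound (Continuous.aestronglyMeasurable (by unfold momentumSymbol; fun_prop)) 1
    (.of_forall fun w => by
      rw [Complex.norm_real]; exact Real.abs_cos_le_one _)

/-- By Euler's formula `cos (τ m)` is the mean of the characters for `τ/K` and `-τ/K`, that is, of
two translations. -/
theorem boundedFunction_cos_ae (K τ : ℝ) (g : L2R) :
    boundedFunction (momentum K) (fun l => (Real.cos (τ * l) : ℂ)) g
      =ᵐ[volume] fun ξ => (1 / 2 : ℂ) * (g (ξ + τ / K) + g (ξ - τ / K)) := by
  have h : boundedFunction (momentum K) (fun l => (Real.cos (τ * l) : ℂ)) g =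
      (1 / 2 : ℂ) • (translation (τ / K) g + translation (-(τ / K)) g) := by
    rw [momentum_eq_multiplier, boundedFunction_multiplier fourierL2
      (contDiff_momentumSymbol K).continuous.measurable
      (Continuous.measurable (by fun_prop)) (memLp_cos_momentumSymbol K τ),
      translation_eq_multiplierCLM, translation_eq_multiplierCLM]
    apply fourierL2.injective
    apply Lp.ext
    rw [map_smul, map_add]
    filter_upwards [multiplierCLM_ae fourierL2 (memLp_cos_momentumSymbol K τ) g,
      multiplierCLM_ae fourierL2 (memLp_character (τ / K)) g,
      multiplierCLM_ae fourierL2 (memLp_character (-(τ / K))) g,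
      Lp.coeFn_add (fourierL2 (multiplierCLM fourierL2 _ (memLp_character (τ / K)) g))
        (fourierL2 (multiplierCLM fourierL2 _ (memLp_character (-(τ / K))) g)),
      Lp.coeFn_smul (1 / 2 : ℂ)
        (fourierL2 (multiplierCLM fourierL2 _ (memLp_character (τ / K)) g) +
        fourierL2 (multiplierCLM fourierL2 _ (memLp_character (-(τ / K))) g))]
      with w e1 e2 e3 e4 e5
    rw [e1, e5, Pi.smul_apply, e4, Pi.add_apply, e2, e3, smul_eq_mul, ← add_mul, ← mul_assoc]
    congr 1
    have e : τ * momentumSymbol K w = -(2 * Real.pi * (τ / K * w)) := by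
      unfold momentumSymbol; ring
    have e' : 2 * Real.pi * (-(τ / K) * w) = -(2 * Real.pi * (τ / K * w)) := by ring
    rw [e, Real.cos_neg, Complex.ofReal_cos, Complex.cos, character, character, e']
    push_cast; ring_nf
  rw [h]
  filter_upwards [translation_ae (τ / K) g, translation_ae (-(τ / K)) g,
    Lp.coeFn_add (translation (τ / K) g) (translation (-(τ / K)) g),
    Lp.coeFn_smul (1 / 2 : ℂ) (translation (τ / K) g + translation (-(τ / K)) g)]
    with x e1 e2 e3 e4
  rw [e4, Pi.smul_apply, e3, Pi.add_apply, e1, e2, smul_eq_mul, sub_eq_add_neg]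

/-- Both factors are in `L²`, so the Cauchy–Schwarz inequality gives integrability at every point,
not just almost everywhere. -/
theorem convolutionExists_charFn_Icc (a b : ℝ) (g : L2R) :
    ConvolutionExists (charFn (Set.Icc a b)) g (ContinuousLinearMap.mul ℂ ℂ) volume := by
  intro ξ
  have h1 : MemLp (charFn (Set.Icc a b)) 2 (volume : Measure ℝ) :=
    memLp_indicator_const 2 measurableSet_Icc (1 : ℂ) (Or.inr (by simp))
  have h2 : MemLp (fun t => g (ξ - t)) 2 (volume : Measure ℝ) :=
    (Lp.memLp g).comp_measurePreserving (Measure.measurePreserving_sub_left volume ξ)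
  exact h1.integrable_mul h2

theorem convolution_charFn_Icc (a b : ℝ) (g : ℝ → ℂ) (ξ : ℝ) :
    (charFn (Set.Icc a b) ⋆[ContinuousLinearMap.mul ℂ ℂ, volume] g) ξ =
      ∫ t in Set.Icc a b, g (ξ - t) := by
  rw [convolution_def, ← integral_indicator measurableSet_Icc]
  congr 1 with t
  by_cases h : t ∈ Set.Icc a b <;> simp [charFn, h]

theorem abs_sinDivId_le (τ l : ℝ) : |sinDivId τ l| ≤ |τ| := by
  unfold sinDivId
  split_ifs with h
  · rfl
  · rw [abs_div, div_le_iff₀ (abs_pos.mpr h), ← abs_mul]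
    exact Real.abs_sin_le_abs

theorem measurable_sinDivId (τ : ℝ) : Measurable (sinDivId τ) :=
  Measurable.ite (measurableSet_singleton 0) measurable_const (by fun_prop)

theorem memLp_sinDivId_momentumSymbol (K τ : ℝ) :
    MemLp (fun w => ((sinDivId τ (momentumSymbol K w) : ℝ) : ℂ)) ∞ (volume : Measure ℝ) :=
  memLp_top_of_bound (Complex.measurable_ofReal.comp ((measurable_sinDivId τ).comp
    (contDiff_momentumSymbol K).continuous.measurable)).aestronglyMeasurable |τ|
    (.of_forall fun w => by rw [Complex.norm_real]; exact abs_sinDivId_le _ _)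

theorem sign_mul_sin_abs (τ x : ℝ) : Real.sign τ * Real.sin (|τ| * x) = Real.sin (τ * x) := by
  rcases lt_trichotomy τ 0 with h | rfl | h
  · rw [Real.sign_of_neg h, abs_of_neg h, neg_mul, neg_mul, Real.sin_neg]; ring
  · simp
  · rw [Real.sign_of_pos h, abs_of_pos h, one_mul]

/-- The integral of `exp (-2πitw)` over `[-a, a]` is `sin (2πwa) / (πw)`, here with `a = |τ|/K`. The
sign of `τ` turns `sin (|τ| m)` into `sin (τ m)`. -/
theorem setIntegral_character_neg {K : ℝ} (hK : 0 < K) (τ w : ℝ) :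
    ((K / 2 * Real.sign τ : ℝ) : ℂ) * ∫ t in Set.Icc (-(|τ| / K)) (|τ| / K), character (-t) w =
      (sinDivId τ (momentumSymbol K w) : ℂ) := by
  have ha : 0 ≤ |τ| / K := by positivity
  rw [integral_Icc_eq_integral_Ioc, ← intervalIntegral.integral_of_le (by linarith)]
  -- At `w = 0` the symbol vanishes and `sinDivId` takes its separate value `τ`, which equals `(K/2)
  -- sgn τ · 2|τ|/K`.
  by_cases hw : w = 0
  · subst hw
    have hs : Real.sign τ * |τ| = τ := by
      rcases lt_trichotomy τ 0 with h | rfl | h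
      · rw [Real.sign_of_neg h, abs_of_neg h]; ring
      · simp
      · rw [Real.sign_of_pos h, abs_of_pos h, one_mul]
    have h1 : K / 2 * Real.sign τ * (|τ| / K - -(|τ| / K)) = τ := by
      field_simp; linarith
    simp only [character, momentumSymbol, mul_zero, Complex.ofReal_zero, zero_mul, Complex.exp_zero,
      intervalIntegral.integral_const, sinDivId, if_true]
    rw [Complex.real_smul, mul_one, ← Complex.ofReal_mul, h1]
  · have hc : -(2 * Real.pi * w * Complex.I) ≠ 0 := by
      simp [Real.pi_ne_zero, hw]
    have e : ∀ t : ℝ, character (-t) w = Complex.exp (-(2 * Real.pi * w * Complex.I) * t) := by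
      intro t; unfold character; congr 1; push_cast; ring
    simp_rw [e]
    rw [integral_exp_mul_complex hc]
    have hl : momentumSymbol K w ≠ 0 := by
      unfold momentumSymbol; simp [hK.ne', Real.pi_ne_zero, hw]
    rw [sinDivId, if_neg hl, ← sign_mul_sin_abs]
    have hsin : Real.sin (|τ| * momentumSymbol K w) = -Real.sin (2 * Real.pi * w * (|τ| / K)) := by
      rw [← Real.sin_neg]; congr 1; unfold momentumSymbol; ring
    rw [hsin]
    push_cast
    rw [Complex.sin]
    have hπ : (Real.pi : ℂ) ≠ 0 := by simp [Real.pi_ne_zero]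
    have hw' : (w : ℂ) ≠ 0 := by simpa using hw
    have hK' : (K : ℂ) ≠ 0 := by simpa using hK.ne'
    unfold momentumSymbol
    push_cast
    have e1 : -(2 * (Real.pi : ℂ) * w * Complex.I) * (|τ| / K) =
      -(2 * Real.pi * w * (|τ| / K)) * Complex.I := by ring
    have e2 : -(2 * (Real.pi : ℂ) * w * Complex.I) * -(|τ| / K) =
      (2 * Real.pi * w * (|τ| / K)) * Complex.I := by ring
    rw [e1, e2]
    have hI := Complex.I_ne_zero
    have hI2 := Complex.I_sq
    field_simp
    rw [hI2]
    ring

theorem integrable_prod_translate (a b : ℝ) (g φ : L2R) :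
    Integrable (fun z : ℝ × ℝ => g (z.2 - z.1) * (starRingEnd ℂ) (φ z.2))
      ((volume.restrict (Set.Icc a b)).prod volume) := by
  have hgm : AEStronglyMeasurable (fun z : ℝ × ℝ => g (z.2 - z.1))
      ((volume.restrict (Set.Icc a b)).prod volume) := by
    refine (Lp.aestronglyMeasurable g).comp_quasiMeasurePreserving ?_
    exact (quasiMeasurePreserving_sub_of_right_invariant volume
      (volume.restrict (Set.Icc a b))).comp Measure.measurePreserving_swap.quasiMeasurePreserving
  have hφm : AEStronglyMeasurable (fun z : ℝ × ℝ => (starRingEnd ℂ) (φ z.2))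
      ((volume.restrict (Set.Icc a b)).prod volume) :=
    Complex.continuous_conj.comp_aestronglyMeasurable (Lp.aestronglyMeasurable φ).comp_snd
  have hm := hgm.mul hφm
  have h2 : ∀ t : ℝ, MemLp (fun ξ => g (ξ - t)) 2 (volume : Measure ℝ) := fun t =>
    (Lp.memLp g).comp_measurePreserving (measurePreserving_sub_right volume t)
  have h3 : MemLp (fun ξ => (starRingEnd ℂ) (φ ξ)) 2 (volume : Measure ℝ) := (Lp.memLp φ).star
  refine (integrable_prod_iff hm).mpr ⟨.of_forall fun t => (h2 t).integrable_mul h3, ?_⟩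
  -- Since `|g φ| ≤ |g|² + |φ|²` and the norm of `g` is translation invariant, the inner integral is
  -- bounded independently of `t`, which ranges over a set of finite measure.
  refine Integrable.of_bound hm.norm.integral_prod_right' (‖g‖ ^ 2 + ‖φ‖ ^ 2) (.of_forall fun t => ?_)
  have h4 : Integrable (fun ξ => ‖g (ξ - t)‖ ^ 2) (volume : Measure ℝ) :=
    (integrable_norm_sq_L2 g).comp_sub_right t
  rw [Real.norm_of_nonneg (integral_nonneg fun _ => norm_nonneg _), norm_sq_L2_eq_integral g,
    norm_sq_L2_eq_integral φ, ← integral_sub_right_eq_self (fun ξ => ‖g ξ‖ ^ 2) t,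
    ← integral_add h4 (integrable_norm_sq_L2 φ)]
  refine integral_mono ((h2 t).integrable_mul h3).norm (h4.add (integrable_norm_sq_L2 φ))
    fun ξ => ?_
  simp only [norm_mul, RCLike.norm_conj, Pi.mul_apply]
  nlinarith [two_mul_le_add_sq ‖g (ξ - t)‖ ‖φ ξ‖, norm_nonneg (g (ξ - t)), norm_nonneg (φ ξ),
    mul_nonneg (norm_nonneg (g (ξ - t))) (norm_nonneg (φ ξ))]

theorem integrable_prod_character (a b : ℝ) {F : ℝ → ℂ} (hF : Integrable F) :
    Integrable (fun z : ℝ × ℝ => character (-z.1) z.2 * F z.2)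
      ((volume.restrict (Set.Icc a b)).prod volume) := by
  have hF2 : Integrable (fun z : ℝ × ℝ => F z.2)
      ((volume.restrict (Set.Icc a b)).prod volume) := hF.comp_snd _
  refine hF2.bdd_mul (c := 1) ?_ (.of_forall fun z => (norm_character _ _).le)
  exact (continuous_character.comp
    ((continuous_fst.neg).prodMk continuous_snd)).aestronglyMeasurable

theorem inner_translation_neg (t : ℝ) (g φ : L2R) :
    ⟪φ, translation (-t) g⟫_ℂ = ∫ ξ, g (ξ - t) * (starRingEnd ℂ) (φ ξ) := by
  rw [L2.inner_def]
  apply integral_congr_ae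
  filter_upwards [translation_ae (-t) g] with ξ h
  rw [h, sub_eq_add_neg]
  rfl

/-- The multiplier is an average of characters and the operator an average of translations. The weak
form avoids vector-valued integrals: Fubini on the Fourier side moves the average outside, each
character becomes a translation, and Fubini in `ξ` moves the average back in. -/
theorem inner_boundedFunction_sinDivId {K : ℝ} (hK : 0 < K) (τ : ℝ) (g φ : L2R) :
    ⟪φ, boundedFunction (momentum K) (fun l => (sinDivId τ l : ℂ)) g⟫_ℂ =
      ∫ ξ, (((K / 2 * Real.sign τ : ℝ) : ℂ) *
        ∫ t in Set.Icc (-(|τ| / K)) (|τ| / K), g (ξ - t)) * (starRingEnd ℂ) (φ ξ) := by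
  set a := |τ| / K with ha
  set c := ((K / 2 * Real.sign τ : ℝ) : ℂ) with hc
  rw [momentum_eq_multiplier, boundedFunction_multiplier fourierL2
    (f := fun l => (sinDivId τ l : ℂ)) (contDiff_momentumSymbol K).continuous.measurable
    (Complex.measurable_ofReal.comp (measurable_sinDivId τ)) (memLp_sinDivId_momentumSymbol K τ),
    inner_eq_integral fourierL2]
  have hF : Integrable (fun w => fourierL2 g w * (starRingEnd ℂ) (fourierL2 φ w)) :=
    (Lp.memLp (fourierL2 g)).integrable_mul (Lp.memLp (fourierL2 φ)).star
  calc _ = ∫ w, c * ∫ t in Set.Icc (-a) a,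
        character (-t) w * (fourierL2 g w * (starRingEnd ℂ) (fourierL2 φ w)) := by
        apply integral_congr_ae
        filter_upwards [multiplierCLM_ae fourierL2 (memLp_sinDivId_momentumSymbol K τ) g] with w h
        rw [h, integral_mul_const, ← mul_assoc c, hc, ha, setIntegral_character_neg hK, mul_assoc]
    _ = c * ∫ t in Set.Icc (-a) a, ∫ w,
        character (-t) w * (fourierL2 g w * (starRingEnd ℂ) (fourierL2 φ w)) := by
        rw [integral_const_mul]
        congr 1
        exact (integral_integral_swap (integrable_prod_character (-a) a hF)).symm
    _ = c * ∫ t in Set.Icc (-a) a, ∫ ξ, g (ξ - t) * (starRingEnd ℂ) (φ ξ) := by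
        congr 2 with t
        rw [← inner_translation_neg, translation_eq_multiplierCLM, inner_eq_integral fourierL2]
        apply integral_congr_ae
        filter_upwards [multiplierCLM_ae fourierL2 (memLp_character (-t)) g] with w h
        rw [h, mul_assoc]
    _ = c * ∫ ξ, ∫ t in Set.Icc (-a) a, g (ξ - t) * (starRingEnd ℂ) (φ ξ) := by
        congr 1
        exact integral_integral_swap (integrable_prod_translate (-a) a g φ)
    _ = _ := by
        rw [← integral_const_mul]
        congr 1 with ξ
        rw [integral_mul_const, mul_assoc]

/-- Pairing the weak identity with indicators of sets of finite measure shows that both sides have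
the same integral over each such set, hence agree almost everywhere. -/
theorem boundedFunction_sinDivId_ae {K : ℝ} (hK : 0 < K) (τ : ℝ) (g : L2R) :
    boundedFunction (momentum K) (fun l => (sinDivId τ l : ℂ)) g
      =ᵐ[volume] fun ξ => ((K / 2 * Real.sign τ : ℝ) : ℂ) *
        (charFn (Set.Icc (-(|τ| / K)) (|τ| / K)) ⋆[ContinuousLinearMap.mul ℂ ℂ, volume] g) ξ := by
  simp_rw [convolution_charFn_Icc]
  have hind : ∀ (s : Set ℝ) (hs : MeasurableSet s) (hμs : volume s ≠ ⊤) (h : ℝ → ℂ),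
      (fun ξ => h ξ * (starRingEnd ℂ) (indicatorConstLp 2 hs hμs (1 : ℂ) ξ)) =ᵐ[volume]
        s.indicator h := by
    intro s hs hμs h
    filter_upwards [indicatorConstLp_coeFn (p := 2) (hs := hs) (hμs := hμs) (c := (1 : ℂ))]
      with ξ e
    rw [e]
    by_cases hξ : ξ ∈ s <;> simp [hξ]
  refine ae_eq_of_forall_setIntegral_eq_of_sigmaFinite (fun s hs hμs => ?_) (fun s hs hμs => ?_)
    fun s hs hμs => ?_
  · exact integrableOn_Lp_of_measure_ne_top _ fact_one_le_two_ennreal.elim hμs.ne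
  · have h := (integrable_prod_translate (-(|τ| / K)) (|τ| / K) g
      (indicatorConstLp 2 hs hμs.ne (1 : ℂ))).integral_prod_right
    simp_rw [integral_mul_const] at h
    have h' := (integrable_congr (hind s hs hμs.ne _)).mp h
    exact ((integrable_indicator_iff hs).mp h').const_mul _
  · have h := inner_boundedFunction_sinDivId hK τ g (indicatorConstLp 2 hs hμs.ne (1 : ℂ))
    rw [L2.inner_indicatorConstLp_one] at h
    rw [h, integral_congr_ae (hind s hs hμs.ne _), integral_indicator hs]

end Functions

end

theorem theorem1 (K : ℝ) (hK : 0 < K) :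
    squareOp (momentum K) = waveOp K ∧
    StronglyCommute (momentum K) (waveOp K) ∧
    (∀ (τ : ℝ) (g₁ : L2R),
      boundedFunction (momentum K) (fun l => (Real.cos (τ * l) : ℂ)) g₁
        =ᵐ[volume] fun ξ => (1 / 2 : ℂ) * (g₁ (ξ + τ / K) + g₁ (ξ - τ / K))) ∧
    (∀ (τ : ℝ) (g₂ : L2R),
      ConvolutionExists (charFn (Set.Icc (-(|τ| / K)) (|τ| / K))) g₂
        (ContinuousLinearMap.mul ℂ ℂ) volume ∧
      boundedFunction (momentum K) (fun l => (sinDivId τ l : ℂ)) g₂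
        =ᵐ[volume] fun ξ => ((K / 2 * Real.sign τ : ℝ) : ℂ) *
          (charFn (Set.Icc (-(|τ| / K)) (|τ| / K)) ⋆[ContinuousLinearMap.mul ℂ ℂ, volume] g₂) ξ) := by
  refine ⟨?_, ?_, boundedFunction_cos_ae K, fun τ g => ⟨convolutionExists_charFn_Icc _ _ g,
    boundedFunction_sinDivId_ae hK τ g⟩⟩
  · rw [momentum_eq_multiplier, waveOp_eq_multiplier]
    exact squareOp_multiplier _ (contDiff_momentumSymbol K).continuous.measurable
  · rw [momentum_eq_multiplier, waveOp_eq_multiplier]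
    exact stronglyCommute_multiplier _ (contDiff_momentumSymbol K).continuous.measurable
      ((contDiff_momentumSymbol K).pow 2).continuous.measurable
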